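/- Notation. $(a,b,\dots)$ denotes the greatest common divisor. For an integer $n\ge 1$ let $F$ be the free group with basis $x_0,\dots,x_{n-1}$ (subscripts modulo $n$) and let $\theta$ be the automorphism of $F$ with $\theta(x_i)=x_{i+1}$. For $w\in F$ put $G_n(w)=\langle x_0,\dots,x_{n-1}\mid w,\theta(w),\dots,\theta^{n-1}(w)\rangle$. For integers $f$ and $r\ge 0$ let $\Lambda(r,f)=x_0x_fx_{2f}\cdots x_{(r-1)f}$, and for $r<0$ let $\Lambda(r,f)=\theta^{rf}(\Lambda(|r|,f))^{-1}$. For integers $M,N\geq 1$, $R$, $\lambda$ let \[B(M,N,R,\lambda)=\left\langle a,b \,\middle|\, a^M=1,\ bab^{-1}=a^R,\ b^N=a^{\lambda M/(M,R-1)}\right\rangle .\] Theorem C. Let $n\ge 1$ and $r,s,f,A$ be integers with $f(r-s)\equiv 0 \bmod n$, and let $G=G_n(w)$ be the cyclically presented group of the class $\mathfrak{M}$ with parameters $(r,n,s,f,A)$, that is, \[w=\begin{cases}\Lambda(r,f)\,\theta^{A}(\Lambda(s,f))^{-1} & \text{if } s\ge 0,\\ \Lambda(r,f)\,\theta^{A+fr}(\Lambda(|s|,f))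 & \text{if } s<0.\end{cases}\] Suppose that $(r,s)=1$ and that $\mu=|r^{n/(n,A)}-s^{n/(n,A)}|\neq 0$. Let $\hat r$ and $\bar\alpha$ be any integers with $r\hat r\equiv 1 \bmod \mu$ and $\alpha\bar\alpha\equiv 1 \bmod n/(n,A)$, where $\alpha=A/(n,A)$. Put \[M=\frac{(n,f)\mu}{n},\qquad N=\frac{n(n,A,f)}{(n,A)(n,f)},\qquad R=(s\hat r)^{f\bar\alpha/(n,A,f)},\qquad \bar G=B(M,N,R,1),\] where, if the exponent of $s\hat r$ is negative, the power is formed with an inverse of $s\hat r$ modulo $M$. Then $M$ and $N$ are integers, $R^N\equiv 1 \bmod M$, and $\bar G$ is a finite metacyclic group (it has a cyclic normal subgroup with cyclic quotient). Moreover $G$ is the free product of $(n,A,f)$ copies of $\bar G$ and the free group $F_k$ of rank $k=(n,A)-(n,A,f)$: \[G\cong\left(\ast_{i=1}^{(n,A,f)}\bar G\right)\ast F_k .\] In particular, if $(n,A)(n,f)=n(n,A,f)$, then \[G\cong\left(\ast_{i=1}^{(n,A,f)}\mathbb{Z}_{(n,f)\mu/n}\right)\ast F_k .\] -/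

import Mathlib

/-- The shift automorphism `x_i ↦ x_{i+1}` of the free group on `x_i`, `i` an integer modulo `n`. -/
def shift (n : ℕ) : MulAut (FreeGroup (ZMod n)) :=
  FreeGroup.freeGroupCongr (Equiv.addRight (1 : ZMod n))

/-- The cyclically presented group `G_n(w) = ⟨x_0, …, x_{n-1} | w, θ(w), …, θ^{n-1}(w)⟩`. -/
abbrev CyclicallyPresentedGroup (n : ℕ) (w : FreeGroup (ZMod n)) : Type :=
  PresentedGroup {u : FreeGroup (ZMod n) | ∃ k : ℕ, k < n ∧ u = (shift n ^ k) w}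

/-- The positive block `Λ(l, f) = x_0 x_f x_{2f} ⋯ x_{(l-1)f}` of length `l` and step size `f`. -/
def block (n : ℕ) (f : ℤ) (l : ℕ) : FreeGroup (ZMod n) :=
  ((List.range l).map fun i => FreeGroup.of (((i : ℤ) * f : ℤ) : ZMod n)).prod

/-- `Λ(r, f)` for an integer `r`. In the shift extension, where `x_i = t^i x_0 t^{-i}` and
`y = x_0 t^f`, one has `y^r = Λ(r, f) t^{rf}`; for negative `r` this forces
`Λ(r, f) = θ^{rf}(Λ(|r|, f))⁻¹ = (x_{-f})⁻¹ (x_{-2f})⁻¹ ⋯ (x_{rf})⁻¹`. -/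
def intBlock (n : ℕ) (f r : ℤ) : FreeGroup (ZMod n) :=
  if 0 ≤ r then block n f r.natAbs
  else ((shift n ^ (r * f)) (block n f r.natAbs))⁻¹

/-- The defining word of the group of type `𝔐` with parameters `(r, n, s, f, A)`:
`Λ(r,f) θ^A(Λ(s,f))⁻¹` if `s ≥ 0`, and `Λ(r,f) θ^{A+fr}(Λ(|s|,f))` if `s < 0`. -/
def wordM (r : ℤ) (n : ℕ) (s f A : ℤ) : FreeGroup (ZMod n) :=
  if 0 ≤ s then intBlock n f r * ((shift n ^ A) (block n f s.natAbs))⁻¹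
  else intBlock n f r * (shift n ^ (A + f * r)) (block n f s.natAbs)

/-- The cyclically presented group of type `𝔐` determined by `(r, n, s, f, A)`
(where `f (r - s) ≡ 0` modulo `n`). -/
abbrev GroupM (r : ℤ) (n : ℕ) (s f A : ℤ) : Type :=
  CyclicallyPresentedGroup n (wordM r n s f A)

/-- Relators of `B(M, N, R, l)`, with `a` the generator `0` and `b` the generator `1`. -/
def beylRels (M N : ℕ) (R l : ℤ) : Set (FreeGroup (Fin 2)) :=
  let a : FreeGroup (Fin 2) := FreeGroup.of 0
  let b : FreeGroup (Fin 2) := FreeGroup.of 1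
  {a ^ M,
   b * a * b⁻¹ * (a ^ R)⁻¹,
   b ^ N * (a ^ (l * ((M / Int.gcd M (R - 1) : ℕ) : ℤ)))⁻¹}

/-- `B(M, N, R, l) = ⟨a, b | a^M = 1, b a b⁻¹ = a^R, b^N = a^{l M / (M, R - 1)}⟩`. -/
abbrev BeylGroup (M N : ℕ) (R l : ℤ) : Type :=
  PresentedGroup (beylRels M N R l)

/-- A group is metacyclic if it has a cyclic normal subgroup with cyclic quotient. -/
def IsMetacyclic (G : Type*) [Group G] : Prop :=
  ∃ (K : Subgroup G) (_ : K.Normal), IsCyclic K ∧ IsCyclic (G ⧸ K)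

/-- The power `b ^ e` of an integer `b` coprime to `M`, as an integer that matters modulo `M`:
the usual power for `e ≥ 0`, and a power of an inverse of `b` modulo `M` for `e < 0`
(the Bézout coefficient `Int.gcdA b M` is such an inverse). -/
def powMod (M : ℕ) (b : ℤ) : ℤ → ℤ
  | Int.ofNat k => b ^ k
  | Int.negSucc k => Int.gcdA b M ^ (k + 1)

/-!
Let `H = ⟨y, v | v y ^ r v⁻¹ = y ^ s, v ^ p = 1⟩` with `p = n / (n, A)` act on `ℤ/n` by translations
through `ν : H → ℤ/n`, `ν y = f`, `ν v = -A`. Reading `x_i` as the arrow `y` at the vertex `i`, the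
group `G` is the universal group of the action groupoid in which all arrows that come from `⟨v⟩` are
made trivial. As `⟨v⟩` meets the kernel of `ν` trivially, that group is the free product of one copy
of `ker ν` per component, of which there are `(n, A, f)`, and of a free group with one generator for
each of the `(n, A)` orbits of `⟨v⟩` beyond one orbit per component.

In `H`, `y` has order `|r ^ p - s ^ p| = μ` and generates a normal subgroup on which `v` acts as
`s / r`, and `|H| = μ p`. With `k = (n, A) / (n, A, f)` and `d = (n, f) / (n, A, f)`, the kernel of
`ν` has order `M N` and is generated by a power `y ^ (k N c)` and `y ^ k v ^ (d j)`, where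
`j ≡ f ᾱ / (n, f)` modulo `N`. A unit `c` modulo `M` for which these satisfy the relations of
`B(M, N, R, 1)` exists because the norm `1 + T + ⋯ + T ^ (N - 1)` of `T = (s / r) ^ (d j)` is
`N M / (M, R - 1)` up to a unit.
-/

section TwoGenerated

variable {G : Type*} [Group G] {a b : G}

theorem zpow_eq_zpow_of_modEq {M : ℕ} (ha : a ^ M = 1) {i j : ℤ} (hij : i ≡ j [ZMOD M]) :
    a ^ i = a ^ j :=
  zpow_eq_zpow_iff_modEq.2 (hij.of_dvd (Int.natCast_dvd_natCast.2 (orderOf_dvd_of_pow_eq_one ha)))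

theorem pow_mul_zpow_mul_pow_inv {r s : ℤ} (hab : b * a ^ r * b⁻¹ = a ^ s) (j : ℕ) (i : ℤ) :
    b ^ j * a ^ (r ^ j * i) * (b ^ j)⁻¹ = a ^ (s ^ j * i) := by
  induction j generalizing i with
  | zero => simp
  | succ j ih =>
    calc b ^ (j + 1) * a ^ (r ^ (j + 1) * i) * (b ^ (j + 1))⁻¹
        = b * (b ^ j * a ^ (r ^ j * (r * i)) * (b ^ j)⁻¹) * b⁻¹ := by
          rw [pow_succ' b, pow_succ r, mul_assoc (r ^ j)]; group
      _ = (b * a ^ r * b⁻¹) ^ (s ^ j * i) := by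
          rw [ih, conj_zpow, ← zpow_mul]; congr 3; ring
      _ = a ^ (s ^ (j + 1) * i) := by
          rw [hab, ← zpow_mul]; congr 1; ring

theorem mul_mul_zpow_mul_inv {R : ℤ} (hab : b * a * b⁻¹ = a ^ R) (k z : ℤ) :
    a ^ k * b * a ^ z * (a ^ k * b)⁻¹ = (a ^ z) ^ R := by
  calc a ^ k * b * a ^ z * (a ^ k * b)⁻¹ = a ^ k * (b * a * b⁻¹) ^ z * (a ^ k)⁻¹ := by
        rw [conj_zpow]; group
    _ = (a ^ z) ^ R := by
        rw [hab, ← zpow_mul, ← zpow_mul, (Commute.zpow_zpow_self a k (R * z)).eq,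
          mul_inv_cancel_right, mul_comm R]

theorem zpow_mul_pow {R : ℤ} (hab : b * a * b⁻¹ = a ^ R) (k : ℤ) (t : ℕ) :
    (a ^ k * b) ^ t = a ^ (k * ∑ i ∈ Finset.range t, R ^ i) * b ^ t := by
  induction t with
  | zero => simp
  | succ t ih =>
    set S := ∑ i ∈ Finset.range t, R ^ i
    have hcomm : b * a ^ (k * S) = a ^ (R * (k * S)) * b := by
      rw [← mul_inv_eq_iff_eq_mul, ← conj_zpow, hab, ← zpow_mul]
    calc (a ^ k * b) ^ (t + 1) = a ^ k * (b * a ^ (k * S)) * b ^ t := by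
          rw [pow_succ', ih]; group
      _ = a ^ (k * ∑ i ∈ Finset.range (t + 1), R ^ i) * b ^ (t + 1) := by
          rw [hcomm, geom_sum_succ, pow_succ', mul_add, mul_one, add_comm, zpow_add,
            mul_left_comm k R, mul_assoc, mul_assoc, mul_assoc]

theorem zpow_mem_zpowers_zpow_of_isCoprime {m M : ℕ} {c : ℤ} (ha : a ^ (m * M) = 1)
    (hc : IsCoprime c M) (i : ℤ) : a ^ (m * i) ∈ Subgroup.zpowers (a ^ (m * c)) := by
  obtain ⟨u, w, huw⟩ := hc
  refine ⟨u * i, (zpow_mul ..).symm.trans ?_⟩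
  refine zpow_eq_zpow_of_modEq ha (Int.modEq_iff_dvd.2 ⟨w * i, ?_⟩)
  push_cast
  linear_combination -(m * i : ℤ) * huw

theorem mk_mem_zpowers_of_closure_eq_top {K : Subgroup G} [K.Normal]
    (hgen : Subgroup.closure {a, b} = ⊤) (ha : a ∈ K) (q : G ⧸ K) :
    q ∈ Subgroup.zpowers (b : G ⧸ K) := by
  have hle : Subgroup.closure {a, b} ≤
      (Subgroup.zpowers (b : G ⧸ K)).comap (QuotientGroup.mk' K) := by
    rw [Subgroup.closure_le]
    rintro g (rfl | rfl)
    · have hg : (g : G ⧸ K) = 1 := (QuotientGroup.eq_one_iff g).2 ha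
      rw [SetLike.mem_coe, Subgroup.mem_comap, QuotientGroup.mk'_apply, hg]
      exact Subgroup.one_mem _
    · exact Subgroup.mem_zpowers _
  obtain ⟨g, rfl⟩ := QuotientGroup.mk_surjective q
  exact hle (hgen ▸ Subgroup.mem_top g)

theorem normal_zpowers_of_conj_mem (hgen : Subgroup.closure {a, b} = ⊤) (ha : IsOfFinOrder a)
    (hab : b * a * b⁻¹ ∈ Subgroup.zpowers a) : (Subgroup.zpowers a).Normal := by
  have : Finite (Subgroup.zpowers a) := finite_zpowers.2 ha
  rw [← Subgroup.normalizer_eq_top_iff, eq_top_iff, ← hgen, Subgroup.closure_le]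
  rintro g (rfl | rfl)
  · exact Subgroup.le_normalizer (Subgroup.mem_zpowers g)
  · refine Subgroup.mem_normalizer_fintype ?_
    rintro _ ⟨i, rfl⟩
    change g * a ^ i * g⁻¹ ∈ Subgroup.zpowers a
    rw [← conj_zpow]
    exact Subgroup.zpow_mem _ hab i

theorem exists_zpow_mul_zpow (hgen : Subgroup.closure {a, b} = ⊤) (ha : IsOfFinOrder a)
    (hab : b * a * b⁻¹ ∈ Subgroup.zpowers a) (g : G) : ∃ i j : ℤ, g = a ^ i * b ^ j := by
  have := normal_zpowers_of_conj_mem hgen ha hab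
  obtain ⟨j, hj : (b : G ⧸ Subgroup.zpowers a) ^ j = g⟩ :=
    mk_mem_zpowers_of_closure_eq_top hgen (Subgroup.mem_zpowers a) (g : G ⧸ Subgroup.zpowers a)
  rw [← QuotientGroup.mk_zpow, eq_comm, QuotientGroup.eq_iff_div_mem] at hj
  obtain ⟨i, hi : a ^ i = g / b ^ j⟩ := hj
  exact ⟨i, j, (div_eq_iff_eq_mul.1 hi.symm)⟩

theorem isMetacyclic_of_conj_mem (hgen : Subgroup.closure {a, b} = ⊤) (ha : IsOfFinOrder a)
    (hab : b * a * b⁻¹ ∈ Subgroup.zpowers a) : IsMetacyclic G :=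
  have := normal_zpowers_of_conj_mem hgen ha hab
  ⟨Subgroup.zpowers a, this, inferInstance,
    ⟨b, mk_mem_zpowers_of_closure_eq_top hgen (Subgroup.mem_zpowers a)⟩⟩

theorem card_dvd_of_conj_mem {M N : ℕ} [NeZero M] (hgen : Subgroup.closure {a, b} = ⊤)
    (ha : a ^ M = 1) (hab : b * a * b⁻¹ ∈ Subgroup.zpowers a) (hb : b ^ N ∈ Subgroup.zpowers a) :
    Nat.card G ∣ M * N := by
  have := normal_zpowers_of_conj_mem hgen (isOfFinOrder_iff_pow_eq_one.2 ⟨M, NeZero.pos M, ha⟩) hab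
  have hindex : (Subgroup.zpowers a).index ∣ N := by
    rw [Subgroup.index, ← orderOf_eq_card_of_forall_mem_zpowers
      (mk_mem_zpowers_of_closure_eq_top hgen (Subgroup.mem_zpowers a))]
    exact orderOf_dvd_of_pow_eq_one ((QuotientGroup.eq_one_iff _).2 hb)
  rw [← (Subgroup.zpowers a).card_mul_index, Nat.card_zpowers]
  exact mul_dvd_mul (orderOf_dvd_of_pow_eq_one ha) hindex

end TwoGenerated

section Cocycles

variable {H Z X Y : Type*} [Group H] [Group Z] [Group X] [Group Y]

/-- An `X`-valued cocycle on the action groupoid of the translation action of `H` on `Z` through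
`ν`, where `φ h z` is the value on the arrow `z ⟶ z * ν h`; it is relative to the subgroup `U` if
it is trivial on all arrows that come from `U`. -/
structure IsRelativeCocycle (ν : H →* Z) (U : Subgroup H) (φ : H → Z → X) : Prop where
  protected map_mul : ∀ g h z, φ (g * h) z = φ g z * φ h (z * ν g)
  map_of_mem : ∀ u ∈ U, ∀ z, φ u z = 1

namespace IsRelativeCocycle

variable {ν : H →* Z} {U : Subgroup H} {φ : H → Z → X}

theorem map_mul_inv (hφ : IsRelativeCocycle ν U φ) {g h : H} {z w : Z} (hw : w * ν h = z * ν g) :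
    φ (g * h⁻¹) z = φ g z * (φ h w)⁻¹ := by
  have hgh : z * ν (g * h⁻¹) = w := by rw [map_mul, map_inv, ← mul_assoc, ← hw]; group
  rw [eq_mul_inv_iff_mul_eq, ← hgh, ← hφ.map_mul, inv_mul_cancel_right]

theorem comp (hφ : IsRelativeCocycle ν U φ) (F : X →* Y) :
    IsRelativeCocycle ν U fun h z => F (φ h z) where
  map_mul g h z := by rw [hφ.map_mul, map_mul]
  map_of_mem u hu z := by rw [hφ.map_of_mem u hu, map_one]

/-- Cocycles over `ν` are the homomorphisms to the wreath product that lift `ν`. The inverse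
accounts for the wreath product acting by left translations. -/
def toWreath (hφ : IsRelativeCocycle ν U φ) : H →* X ≀ᵣ Z :=
  MonoidHom.mk' (fun h => ⟨fun z => φ h z⁻¹, ν h⟩) fun g h => by
    ext z
    · simp only [hφ.map_mul, RegularWreathProduct.mul_left, Pi.mul_apply, mul_inv_rev, inv_inv]
    · exact map_mul ν g h

theorem of_wreath {σ : H →* X ≀ᵣ Z} (hσ : ∀ h, (σ h).right = ν h)
    (hU : ∀ u ∈ U, (σ u).left = 1) : IsRelativeCocycle ν U fun h z => (σ h).left z⁻¹ where
  map_mul g h z := by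
    simp only [map_mul, RegularWreathProduct.mul_left, Pi.mul_apply, hσ, mul_inv_rev]
  map_of_mem u hu z := by rw [hU u hu, Pi.one_apply]

theorem ext_of_closure_eq_top {ψ : H → Z → X} {S : Set H} (hφ : IsRelativeCocycle ν U φ)
    (hψ : IsRelativeCocycle ν U ψ) (hS : Subgroup.closure S = ⊤)
    (h : ∀ g ∈ S, ∀ z, φ g z = ψ g z) : φ = ψ := by
  have hwreath : hφ.toWreath = hψ.toWreath := MonoidHom.eq_of_eqOn_dense hS fun g hg =>
    RegularWreathProduct.ext (funext fun z => h g hg z⁻¹) rfl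
  funext g z
  simpa [toWreath] using congrFun (congrArg RegularWreathProduct.left
    (DFunLike.congr_fun hwreath g)) z⁻¹

end IsRelativeCocycle

/-- The universal target of the cocycles over `ν` relative to `U`, i.e. the universal group of the
action groupoid of `Z` modulo the arrows that come from `U`. -/
abbrev CocycleGroup (ν : H →* Z) (U : Subgroup H) : Type _ :=
  PresentedGroup ({w : FreeGroup (H × Z) | ∃ g h z, w = FreeGroup.of (g, z) *
    FreeGroup.of (h, z * ν g) * (FreeGroup.of (g * h, z))⁻¹} ∪
    {w | ∃ u ∈ U, ∃ z, w = FreeGroup.of (u, z)})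

namespace CocycleGroup

variable (ν : H →* Z) (U : Subgroup H)

theorem isRelativeCocycle_of :
    IsRelativeCocycle ν U fun h z => (PresentedGroup.of (h, z) : CocycleGroup ν U) where
  map_mul g h z :=
    (PresentedGroup.mk_eq_mk_of_mul_inv_mem (Or.inl ⟨g, h, z, rfl⟩)).symm
  map_of_mem u hu z := PresentedGroup.one_of_mem (Or.inr ⟨u, hu, z, rfl⟩)

variable {ν U} {φ : H → Z → X}

/-- The homomorphism from the universal target induced by a cocycle. -/
def lift (hφ : IsRelativeCocycle ν U φ) : CocycleGroup ν U →* X :=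
  PresentedGroup.toGroup (f := fun a => φ a.1 a.2) <| by
    rintro w (⟨g, h, z, rfl⟩ | ⟨u, hu, z, rfl⟩)
    · simp [hφ.map_mul]
    · simp [hφ.map_of_mem u hu]

@[simp]
theorem lift_of (hφ : IsRelativeCocycle ν U φ) (h : H) (z : Z) :
    lift hφ (PresentedGroup.of (h, z)) = φ h z := by
  simp only [lift, PresentedGroup.toGroup.of]

end CocycleGroup

end Cocycles

section Splitting

variable {H Z X : Type*} [Group H] [Group Z] [Group X] {ν : H →* Z} {U : Subgroup H}

/-- A base vertex in every connected component of the action groupoid together with an arrow from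
it to every vertex of the component, equivariant with respect to `U`. -/
structure EquivariantTransversal (ν : H →* Z) (U : Subgroup H) where
  base : Z ⧸ ν.range → Z
  mk_base : ∀ c, (base c : Z ⧸ ν.range) = c
  arrow : Z → H
  base_mul_arrow : ∀ z : Z, base z * ν (arrow z) = z
  arrow_base : ∀ c, arrow (base c) = 1
  arrow_mul : ∀ z, ∀ u ∈ U, arrow (z * ν u) = arrow z * u

theorem mk_mul_map_eq (ν : H →* Z) (z : Z) (h : H) : ((z * ν h : Z) : Z ⧸ ν.range) = z :=
  QuotientGroup.mk_mul_of_mem z ⟨h, rfl⟩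

theorem mk_mul_map_eq_of_mem (ν : H →* Z) (z : Z) {u : H} (hu : u ∈ U) :
    ((z * ν u : Z) : Z ⧸ U.map ν) = z :=
  QuotientGroup.mk_mul_of_mem z ⟨u, hu, rfl⟩

theorem mk_range_eq_iff {z w : Z} :
    (z : Z ⧸ ν.range) = w ↔ ∃ h, z * ν h = w := by
  rw [QuotientGroup.eq]
  exact exists_congr fun h => eq_inv_mul_iff_mul_eq

theorem mk_map_eq_iff {z w : Z} :
    (z : Z ⧸ U.map ν) = w ↔ ∃ u ∈ U, z * ν u = w := by
  rw [QuotientGroup.eq]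
  exact exists_congr fun u => and_congr_right fun _ => eq_inv_mul_iff_mul_eq

theorem mk_range_eq_of_mk_map_eq {z w : Z} (h : (z : Z ⧸ U.map ν) = w) :
    (z : Z ⧸ ν.range) = w :=
  let ⟨u, _, hu⟩ := mk_map_eq_iff.1 h
  mk_range_eq_iff.2 ⟨u, hu⟩

theorem exists_arrow_from_base {base : Z ⧸ ν.range → Z}
    (mk_base : ∀ c, (base c : Z ⧸ ν.range) = c) (U : Subgroup H) :
    ∃ t : Z ⧸ U.map ν → H, (∀ z : Z, ((base z * ν (t z) : Z) : Z ⧸ U.map ν) = z) ∧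
      ∀ z : Z, (base z : Z ⧸ U.map ν) = z → t z = 1 := by
  have exists_arrow (o : Z ⧸ U.map ν) : ∃ h : H, ∀ z : Z, (z : Z ⧸ U.map ν) = o →
      ((base z * ν h : Z) : Z ⧸ U.map ν) = o ∧ ((base z : Z ⧸ U.map ν) = o → h = 1) := by
    induction o using QuotientGroup.induction_on with | H w
    by_cases hw : (base w : Z ⧸ U.map ν) = w
    · refine ⟨1, fun z hz => ⟨?_, fun _ => rfl⟩⟩
      rw [mk_range_eq_of_mk_map_eq hz, map_one, mul_one, hw]
    · obtain ⟨h, hh⟩ := mk_range_eq_iff.1 (mk_base w)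
      refine ⟨h, fun z hz => ?_⟩
      rw [mk_range_eq_of_mk_map_eq hz, hh]
      exact ⟨rfl, fun hw' => absurd hw' hw⟩
  choose t ht using exists_arrow
  exact ⟨t, fun z => (ht z z rfl).1, fun z => (ht z z rfl).2⟩

theorem nonempty_equivariantTransversal (hU : Disjoint ν.ker U) :
    Nonempty (EquivariantTransversal ν U) := by
  let base (c : Z ⧸ ν.range) : Z := c.out
  have mk_base (c : Z ⧸ ν.range) : (base c : Z ⧸ ν.range) = c := Quotient.out_eq' c
  have hinj {u v : H} (hu : u ∈ U) (hv : v ∈ U) (huv : ν u = ν v) : u = v :=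
    mul_inv_eq_one.1 <| Subgroup.disjoint_def.1 hU
      (by rw [MonoidHom.mem_ker, map_mul, map_inv, huv, mul_inv_cancel])
      (U.mul_mem hu (U.inv_mem hv))
  obtain ⟨toOrbit, htoOrbit, htoOrbit_one⟩ := exists_arrow_from_base mk_base U
  choose inOrbit hmem hinOrbit using fun z => mk_map_eq_iff.1 (htoOrbit z)
  refine ⟨⟨base, mk_base, fun z => toOrbit z * inOrbit z, fun z => ?_, fun c => ?_,
    fun z u hu => ?_⟩⟩
  · rw [map_mul, ← mul_assoc, hinOrbit]
  · have ht := htoOrbit_one (base c) (by rw [mk_base])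
    have hc := hinOrbit (base c)
    rw [ht, mk_base, map_one, mul_one, mul_eq_left] at hc
    rw [ht, one_mul, hinj (hmem _) U.one_mem (hc.trans (map_one ν).symm)]
  · rw [mk_mul_map_eq_of_mem ν z hu, mul_assoc]
    congr 1
    have hz := hinOrbit (z * ν u)
    rw [mk_mul_map_eq_of_mem ν z hu, mk_mul_map_eq] at hz
    refine hinj (hmem _) (U.mul_mem (hmem z) hu) (mul_left_cancel (hz.trans ?_))
    rw [map_mul, ← mul_assoc, hinOrbit]

namespace EquivariantTransversal

variable (T : EquivariantTransversal ν U)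

/-- The `U`-orbits in `Z` that do not contain a base vertex. -/
abbrev FreeIndex : Type _ :=
  {o : Z ⧸ U.map ν // o ∉ Set.range fun c => (T.base c : Z ⧸ U.map ν)}

theorem card_freeIndex [Finite Z] :
    Nat.card T.FreeIndex = Nat.card (Z ⧸ U.map ν) - Nat.card (Z ⧸ ν.range) := by
  have hinj : Function.Injective fun c => (T.base c : Z ⧸ U.map ν) := fun c d h => by
    rw [← T.mk_base c, ← T.mk_base d, mk_range_eq_of_mk_map_eq h]
  rw [← Nat.card_range_of_injective hinj]
  exact Set.ncard_compl _

/-- The free product of one copy of the vertex group per component and of a free group. -/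
abbrev SplitGroup : Type _ :=
  Monoid.Coprod (Monoid.CoprodI fun _ : Z ⧸ ν.range => ν.ker) (FreeGroup T.FreeIndex)

/-- The loop at the base vertex `base z` obtained by conjugating the arrow `h` at `z`. -/
def loop (h : H) (z : Z) : ν.ker :=
  ⟨T.arrow z * h * (T.arrow (z * ν h))⁻¹, by
    have hz := T.base_mul_arrow (z * ν h)
    rw [mk_mul_map_eq] at hz
    rw [MonoidHom.mem_ker, map_mul, map_mul, map_inv, mul_inv_eq_one]
    refine mul_left_cancel (a := T.base z) ?_
    rw [hz, ← mul_assoc, T.base_mul_arrow]⟩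

theorem loop_base (c : Z ⧸ ν.range) (k : ν.ker) : T.loop k (T.base c) = k := by
  have hk : ν k = 1 := k.2
  ext
  simp [loop, hk, T.arrow_base]

theorem loop_arrow (z : Z) : T.loop (T.arrow z) (T.base z) = 1 := by
  ext
  simp [loop, T.base_mul_arrow, T.arrow_base]

open Classical in
/-- The free generator attached to a `U`-orbit, trivial if the orbit contains a base vertex. -/
noncomputable def label (o : Z ⧸ U.map ν) : FreeGroup T.FreeIndex :=
  if h : o ∈ Set.range fun c => (T.base c : Z ⧸ U.map ν) then 1 else FreeGroup.of ⟨o, h⟩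

theorem label_base (c : Z ⧸ ν.range) : T.label (T.base c) = 1 :=
  dif_pos ⟨c, rfl⟩

theorem label_freeIndex (o : T.FreeIndex) : T.label o = FreeGroup.of o :=
  dif_neg o.2

/-- The cocycle that sends an arrow to its loop, corrected by the labels of its end points. -/
noncomputable def splitCocycle (h : H) (z : Z) : T.SplitGroup :=
  (Monoid.Coprod.inr (T.label z))⁻¹ *
    Monoid.Coprod.inl (Monoid.CoprodI.of (M := fun _ : Z ⧸ ν.range => ν.ker)
      (i := (z : Z ⧸ ν.range)) (T.loop h z)) *
    Monoid.Coprod.inr (T.label (z * ν h))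

theorem isRelativeCocycle_splitCocycle : IsRelativeCocycle ν U T.splitCocycle where
  map_mul g h z := by
    have hloop : T.loop (g * h) z = T.loop g z * T.loop h (z * ν g) := by
      ext
      simp [loop, mul_assoc]
    simp [splitCocycle, hloop, mul_assoc]
  map_of_mem u hu z := by
    have hloop : T.loop u z = 1 := by
      ext
      simp [loop, T.arrow_mul z u hu]
    simp [splitCocycle, hloop, mk_mul_map_eq_of_mem ν z hu]

theorem splitCocycle_ker (c : Z ⧸ ν.range) (k : ν.ker) :
    T.splitCocycle k (T.base c) = Monoid.Coprod.inl (Monoid.CoprodI.of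
      (M := fun _ : Z ⧸ ν.range => ν.ker) (i := c) k) := by
  have hk : ν k = 1 := k.2
  simp [splitCocycle, T.loop_base, hk, T.label_base, T.mk_base]

theorem splitCocycle_arrow (o : T.FreeIndex) :
    T.splitCocycle (T.arrow o.1.out) (T.base (o.1.out : Z)) =
      Monoid.Coprod.inr (FreeGroup.of o) := by
  simp [splitCocycle, T.loop_arrow, T.base_mul_arrow, T.label_base, T.label_freeIndex]

variable {T} {φ : H → Z → X} (hφ : IsRelativeCocycle ν U φ)

variable (T) in
/-- The homomorphism from the free product induced by a cocycle. -/
noncomputable def splitLift : T.SplitGroup →* X :=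
  Monoid.Coprod.lift
    (Monoid.CoprodI.lift fun c => MonoidHom.mk' (fun k : ν.ker => φ k (T.base c)) fun k l => by
      rw [Subgroup.coe_mul, hφ.map_mul, k.2, mul_one])
    (FreeGroup.lift fun o => φ (T.arrow o.1.out) (T.base (o.1.out : Z)))

theorem splitLift_ker (c : Z ⧸ ν.range) (k : ν.ker) :
    T.splitLift hφ (Monoid.Coprod.inl (Monoid.CoprodI.of
      (M := fun _ : Z ⧸ ν.range => ν.ker) (i := c) k)) = φ k (T.base c) := by
  simp [splitLift]

theorem splitLift_label (z : Z) :
    T.splitLift hφ (Monoid.Coprod.inr (T.label z)) = φ (T.arrow z) (T.base z) := by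
  by_cases hz : (z : Z ⧸ U.map ν) ∈ Set.range fun c => (T.base c : Z ⧸ U.map ν)
  · obtain ⟨c, hc⟩ := hz
    obtain ⟨u, hu, rfl⟩ := mk_map_eq_iff.1 hc
    rw [← hc, T.label_base, T.arrow_mul _ u hu, T.arrow_base, one_mul,
      hφ.map_of_mem u hu, map_one, map_one]
  · have hout : ((Quotient.out (z : Z ⧸ U.map ν) : Z) : Z ⧸ U.map ν) = z := Quotient.out_eq' _
    obtain ⟨u, hu, hz_eq⟩ := mk_map_eq_iff.1 hout
    have harrow : T.arrow z = T.arrow (Quotient.out (z : Z ⧸ U.map ν)) * u := by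
      rw [← T.arrow_mul _ u hu, hz_eq]
    rw [label, dif_neg hz, harrow, hφ.map_mul, hφ.map_of_mem u hu, mul_one,
      ← mk_range_eq_of_mk_map_eq hout]
    simp [splitLift]

theorem splitLift_splitCocycle (h : H) (z : Z) :
    T.splitLift hφ (T.splitCocycle h z) = φ h z := by
  have hz := T.base_mul_arrow (z * ν h)
  rw [mk_mul_map_eq] at hz
  have hloop : φ (T.loop h z : H) (T.base z) =
      φ (T.arrow z) (T.base z) * φ h z * (φ (T.arrow (z * ν h)) (T.base z))⁻¹ := by
    rw [loop, hφ.map_mul_inv (w := T.base z), hφ.map_mul, T.base_mul_arrow]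
    rw [hz, map_mul, ← mul_assoc, T.base_mul_arrow]
  rw [splitCocycle, map_mul, map_mul, map_inv, splitLift_label, splitLift_label, splitLift_ker,
    mk_mul_map_eq, hloop]
  group

variable (T) in
/-- The universal group of the action groupoid relative to `U` splits as a free product. -/
noncomputable def cocycleGroupMulEquiv : CocycleGroup ν U ≃* T.SplitGroup :=
  MonoidHom.toMulEquiv (CocycleGroup.lift T.isRelativeCocycle_splitCocycle)
    (T.splitLift (CocycleGroup.isRelativeCocycle_of ν U))
    (PresentedGroup.ext fun ⟨h, z⟩ => by
      rw [MonoidHom.comp_apply, CocycleGroup.lift_of, splitLift_splitCocycle, MonoidHom.id_apply])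
    (Monoid.Coprod.hom_ext
      (Monoid.CoprodI.ext_hom _ _ fun c => by
        ext k
        simp only [MonoidHom.comp_apply, splitLift_ker, CocycleGroup.lift_of, splitCocycle_ker,
          MonoidHom.id_apply])
      (by
        ext o
        simp only [MonoidHom.comp_apply, MonoidHom.id_apply]
        rw [← T.label_freeIndex o, ← QuotientGroup.out_eq' o.1, splitLift_label,
          CocycleGroup.lift_of, splitCocycle_arrow, QuotientGroup.out_eq' o.1, T.label_freeIndex]))

end EquivariantTransversal

/-- Free products of copies of isomorphic groups over equivalent index types are isomorphic. -/
def coprodIConstCongr {I J G G' : Type*} [Group G] [Group G'] (e : I ≃ J) (F : G ≃* G') :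
    Monoid.CoprodI (fun _ : I => G) ≃* Monoid.CoprodI (fun _ : J => G') :=
  MonoidHom.toMulEquiv
    (Monoid.CoprodI.lift fun i =>
      (Monoid.CoprodI.of (M := fun _ : J => G') (i := e i)).comp F.toMonoidHom)
    (Monoid.CoprodI.lift fun j =>
      (Monoid.CoprodI.of (M := fun _ : I => G) (i := e.symm j)).comp F.symm.toMonoidHom)
    (Monoid.CoprodI.ext_hom _ _ fun i => by
      ext a
      simp)
    (Monoid.CoprodI.ext_hom _ _ fun j => by
      ext a
      simp)

theorem nonempty_cocycleGroup_mulEquiv_of_disjoint [Finite Z] (hU : Disjoint ν.ker U)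
    (e : ν.ker ≃* X) :
    Nonempty (CocycleGroup ν U ≃*
      Monoid.Coprod (Monoid.CoprodI fun _ : Fin ν.range.index => X)
        (FreeGroup (Fin ((U.map ν).index - ν.range.index)))) := by
  obtain ⟨T⟩ := nonempty_equivariantTransversal hU
  have eFree : T.FreeIndex ≃ Fin ((U.map ν).index - ν.range.index) :=
    (Finite.equivFin _).trans (finCongr T.card_freeIndex)
  exact ⟨T.cocycleGroupMulEquiv.trans <| MulEquiv.coprodCongr
    (coprodIConstCongr (Finite.equivFin (Z ⧸ ν.range)) e) (FreeGroup.freeGroupCongr eFree)⟩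

end Splitting

section Words

variable {n : ℕ}

theorem shift_zpow (j : ℤ) :
    shift n ^ j = FreeGroup.freeGroupCongr (Equiv.addRight (j : ZMod n)) := by
  let shiftHom : Multiplicative ℤ →* MulAut (FreeGroup (ZMod n)) :=
    MonoidHom.mk' (fun i => FreeGroup.freeGroupCongr (Equiv.addRight (i.toAdd : ZMod n)))
      fun i j => MulEquiv.toMonoidHom_injective <| FreeGroup.ext_hom _ _ fun k => by
        simp [MulAut.mul_apply, add_left_comm, add_comm]
  have h_one : shiftHom (Multiplicative.ofAdd 1) = shift n := by
    simp [shiftHom, shift]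
  calc shift n ^ j = shiftHom (Multiplicative.ofAdd 1 ^ j) := by rw [map_zpow, h_one]
    _ = FreeGroup.freeGroupCongr (Equiv.addRight (j : ZMod n)) := by
      rw [← ofAdd_zsmul, zsmul_one, Int.cast_id]
      rfl

theorem shift_zpow_of (j : ℤ) (i : ZMod n) :
    (shift n ^ j) (FreeGroup.of i) = FreeGroup.of (i + j) := by
  rw [shift_zpow, FreeGroup.freeGroupCongr_apply, FreeGroup.map.of, Equiv.coe_addRight]

theorem block_succ (f : ℤ) (l : ℕ) :
    block n f (l + 1) = block n f l * FreeGroup.of (((l * f : ℤ)) : ZMod n) := by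
  simp [block, List.range_succ]

theorem wordM_eq_intBlock_mul {r s f : ℤ} (A : ℤ) (hf : f * (r - s) ≡ 0 [ZMOD n]) :
    wordM r n s f A = intBlock n f r * ((shift n ^ A) (intBlock n f s))⁻¹ := by
  unfold wordM
  split_ifs with hs
  · rw [intBlock, intBlock, if_pos hs]
  · have hshift : shift n ^ (A + f * r) = shift n ^ (A + s * f) := by
      have hfrs := (ZMod.intCast_eq_intCast_iff _ _ n).2 hf
      rw [shift_zpow, shift_zpow]
      congr 2
      push_cast at hfrs ⊢
      linear_combination hfrs
    rw [intBlock, intBlock, if_neg hs, map_inv, inv_inv, ← MulAut.mul_apply, ← zpow_add, hshift]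

variable {X : Type*} [Group X]

/-- The element of the wreath product with translation part `f` whose base part is a family of
elements indexed by `ZMod n`, reflected because the wreath product acts by left translations. -/
def wreathGen (x : ZMod n → X) (f : ℤ) : X ≀ᵣ Multiplicative (ZMod n) :=
  ⟨fun z => x (-z.toAdd), Multiplicative.ofAdd (f : ZMod n)⟩

theorem wreathGen_zpow_right (x : ZMod n → X) (f r : ℤ) :
    (wreathGen x f ^ r).right = Multiplicative.ofAdd ((r * f : ℤ) : ZMod n) := by
  rw [← RegularWreathProduct.rightHom_eq_right, map_zpow, RegularWreathProduct.rightHom_eq_right,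
    wreathGen, ← ofAdd_zsmul, zsmul_eq_mul, Int.cast_mul]

theorem wreathGen_pow_left (x : ZMod n → X) (f : ℤ) (l : ℕ) (j : ℤ) :
    (wreathGen x f ^ l).left (Multiplicative.ofAdd (-(j : ZMod n))) =
      FreeGroup.lift x ((shift n ^ j) (block n f l)) := by
  induction l with
  | zero => simp [block]
  | succ l ih =>
    have hright := wreathGen_zpow_right x f l
    rw [zpow_natCast] at hright
    rw [pow_succ, RegularWreathProduct.mul_left, Pi.mul_apply, ih, block_succ, map_mul, map_mul,
      shift_zpow_of, FreeGroup.lift_apply_of, hright, wreathGen]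
    simp [add_comm]

theorem wreathGen_zpow_left (x : ZMod n → X) (f r j : ℤ) :
    (wreathGen x f ^ r).left (Multiplicative.ofAdd (-(j : ZMod n))) =
      FreeGroup.lift x ((shift n ^ j) (intBlock n f r)) := by
  unfold intBlock
  split_ifs with hr
  · rw [← wreathGen_pow_left, ← zpow_natCast, Int.natAbs_of_nonneg hr]
  · have hr' : (r.natAbs : ℤ) = -r := by omega
    have hinv : wreathGen x f ^ r = (wreathGen x f ^ r.natAbs)⁻¹ := by
      rw [← zpow_natCast, hr', zpow_neg, inv_inv]
    have hright := wreathGen_zpow_right x f r.natAbs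
    rw [zpow_natCast, hr'] at hright
    rw [map_inv, map_inv, ← MulAut.mul_apply, ← zpow_add, ← wreathGen_pow_left, hinv,
      RegularWreathProduct.inv_left]
    simp only [Pi.inv_apply, hright, ← ofAdd_add]
    congr 3
    push_cast
    ring

/-- The wreath product collects the `n` shifts of the relator into the single relation
`y ^ r * t = t * y ^ s`. -/
theorem forall_lift_wordM_eq_one_iff [NeZero n] (x : ZMod n → X) {r s f : ℤ} (A : ℤ)
    (hf : f * (r - s) ≡ 0 [ZMOD n]) :
    (∀ k : ℕ, k < n → FreeGroup.lift x ((shift n ^ k) (wordM r n s f A)) = 1) ↔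
      wreathGen x f ^ r * RegularWreathProduct.inl (Multiplicative.ofAdd (A : ZMod n)) =
        RegularWreathProduct.inl (Multiplicative.ofAdd (A : ZMod n)) * wreathGen x f ^ s := by
  set t : X ≀ᵣ Multiplicative (ZMod n) :=
    RegularWreathProduct.inl (Multiplicative.ofAdd (A : ZMod n)) with ht
  have hright : (wreathGen x f ^ r * t).right = (t * wreathGen x f ^ s).right := by
    have hfrs := (ZMod.intCast_eq_intCast_iff _ _ n).2 hf
    rw [RegularWreathProduct.mul_right, RegularWreathProduct.mul_right, wreathGen_zpow_right,
      wreathGen_zpow_right, ht, RegularWreathProduct.right_inl, ← ofAdd_add, ← ofAdd_add]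
    congr 1
    push_cast at hfrs ⊢
    linear_combination hfrs
  have hleft (j : ℤ) : FreeGroup.lift x ((shift n ^ j) (wordM r n s f A)) = 1 ↔
      (wreathGen x f ^ r * t).left (Multiplicative.ofAdd (-(j : ZMod n))) =
        (t * wreathGen x f ^ s).left (Multiplicative.ofAdd (-(j : ZMod n))) := by
    rw [wordM_eq_intBlock_mul A hf, map_mul, map_mul, map_inv, map_inv, ← MulAut.mul_apply,
      ← zpow_add, mul_inv_eq_one, ← wreathGen_zpow_left, ← wreathGen_zpow_left]
    simp [ht]
  refine ⟨fun h => RegularWreathProduct.ext (funext fun z => ?_) hright, fun h k _ => ?_⟩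
  · have hz := (hleft ((-z.toAdd).val : ℕ)).1 (by rw [zpow_natCast]; exact h _ (ZMod.val_lt _))
    simpa using hz
  · rw [← zpow_natCast, hleft, h]

end Words

section BaumslagSolitar

/-- Relators of `⟨y, v | v y ^ r v⁻¹ = y ^ s, v ^ p = 1⟩`, with `y` the generator `0` and `v` the
generator `1`. -/
def baumslagSolitarRels (r s : ℤ) (p : ℕ) : Set (FreeGroup (Fin 2)) :=
  {FreeGroup.of 1 * FreeGroup.of 0 ^ r * (FreeGroup.of 1)⁻¹ * (FreeGroup.of 0 ^ s)⁻¹,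
    FreeGroup.of 1 ^ p}

/-- The quotient `⟨y, v | v y ^ r v⁻¹ = y ^ s, v ^ p = 1⟩` of a Baumslag–Solitar group. -/
abbrev BaumslagSolitarQuotient (r s : ℤ) (p : ℕ) : Type :=
  PresentedGroup (baumslagSolitarRels r s p)

namespace BaumslagSolitarQuotient

variable {r s : ℤ} {p : ℕ} {X : Type*} [Group X]

/-- The generator whose powers are conjugated. -/
def y : BaumslagSolitarQuotient r s p := PresentedGroup.of 0

/-- The generator that acts by conjugation, of finite order. -/
def v : BaumslagSolitarQuotient r s p := PresentedGroup.of 1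

theorem v_mul_y_zpow_mul_v_inv : (v : BaumslagSolitarQuotient r s p) * y ^ r * v⁻¹ = y ^ s :=
  PresentedGroup.mk_eq_mk_of_mul_inv_mem (Or.inl rfl)

theorem v_pow : (v : BaumslagSolitarQuotient r s p) ^ p = 1 :=
  PresentedGroup.one_of_mem (Or.inr rfl)

theorem closure_y_v : Subgroup.closure {y, (v : BaumslagSolitarQuotient r s p)} = ⊤ := by
  rw [← PresentedGroup.closure_range_of]
  congr 1
  ext g
  simp [Fin.exists_fin_two, y, v, eq_comm]

/-- The homomorphism determined by elements that satisfy the relations. -/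
def lift (a b : X) (hab : b * a ^ r * b⁻¹ = a ^ s) (hb : b ^ p = 1) :
    BaumslagSolitarQuotient r s p →* X :=
  PresentedGroup.toGroup (f := ![a, b]) <| by
    rintro w (rfl | rfl)
    · simp [hab]
    · simp [hb]

variable {a b : X} {hab : b * a ^ r * b⁻¹ = a ^ s} {hb : b ^ p = 1}

@[simp]
theorem lift_y : lift a b hab hb y = a := by
  simp only [lift, y, PresentedGroup.toGroup.of, Matrix.cons_val_zero]

@[simp]
theorem lift_v : lift a b hab hb v = b := by
  simp only [lift, v, PresentedGroup.toGroup.of, Matrix.cons_val_one, Matrix.cons_val_fin_one]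

theorem hom_ext {F F' : BaumslagSolitarQuotient r s p →* X} (hy : F y = F' y) (hv : F v = F' v) :
    F = F' :=
  PresentedGroup.ext fun i => by
    fin_cases i
    exacts [hy, hv]

end BaumslagSolitarQuotient

open BaumslagSolitarQuotient

variable {n : ℕ} {r s f A : ℤ} {p : ℕ} {X : Type*} [Group X]
  {ν : BaumslagSolitarQuotient r s p →* Multiplicative (ZMod n)}

theorem mul_sub_modEq_zero_of_map_y (hνy : ν y = Multiplicative.ofAdd (f : ZMod n)) :
    f * (r - s) ≡ 0 [ZMOD n] := by
  have hrel := congrArg ν (v_mul_y_zpow_mul_v_inv (r := r) (s := s) (p := p))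
  rw [map_mul, map_mul, map_inv, mul_inv_cancel_comm, map_zpow, map_zpow, hνy, ← ofAdd_zsmul,
    ← ofAdd_zsmul, Multiplicative.ofAdd.injective.eq_iff, zsmul_eq_mul, zsmul_eq_mul] at hrel
  rw [← ZMod.intCast_eq_intCast_iff]
  push_cast
  linear_combination hrel

theorem lift_shift_wordM_eq_one_of_isRelativeCocycle [NeZero n]
    (hνy : ν y = Multiplicative.ofAdd (f : ZMod n))
    (hνv : ν v = (Multiplicative.ofAdd (A : ZMod n))⁻¹)
    {ψ : BaumslagSolitarQuotient r s p → Multiplicative (ZMod n) → X}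
    (hψ : IsRelativeCocycle ν (Subgroup.zpowers v) ψ) {k : ℕ} (hk : k < n) :
    FreeGroup.lift (fun i => ψ y (Multiplicative.ofAdd i)) ((shift n ^ k) (wordM r n s f A)) =
      1 := by
  have hy : hψ.toWreath y = wreathGen (fun i => ψ y (Multiplicative.ofAdd i)) f :=
    RegularWreathProduct.ext rfl hνy
  have hv : hψ.toWreath v = (RegularWreathProduct.inl (Multiplicative.ofAdd (A : ZMod n)))⁻¹ := by
    rw [← map_inv, ← hνv]
    exact RegularWreathProduct.ext
      (funext fun z => hψ.map_of_mem v (Subgroup.mem_zpowers v) z⁻¹) rfl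
  have hrel := congrArg hψ.toWreath (v_mul_y_zpow_mul_v_inv (r := r) (s := s) (p := p))
  rw [map_mul, map_mul, map_inv, map_zpow, map_zpow, hy, hv, inv_inv, mul_assoc,
    inv_mul_eq_iff_eq_mul] at hrel
  exact (forall_lift_wordM_eq_one_iff _ A (mul_sub_modEq_zero_of_map_y hνy)).2 hrel k hk

theorem exists_isRelativeCocycle_groupM [NeZero n]
    (hνy : ν y = Multiplicative.ofAdd (f : ZMod n))
    (hνv : ν v = (Multiplicative.ofAdd (A : ZMod n))⁻¹) :
    ∃ φ : BaumslagSolitarQuotient r s p → Multiplicative (ZMod n) → GroupM r n s f A,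
      IsRelativeCocycle ν (Subgroup.zpowers v) φ ∧
        ∀ i, φ y (Multiplicative.ofAdd i) = PresentedGroup.of i := by
  let x (i : ZMod n) : GroupM r n s f A := PresentedGroup.of i
  let t : GroupM r n s f A ≀ᵣ Multiplicative (ZMod n) :=
    RegularWreathProduct.inl (Multiplicative.ofAdd (A : ZMod n))
  have hx (k : ℕ) (hk : k < n) : FreeGroup.lift x ((shift n ^ k) (wordM r n s f A)) = 1 := by
    have hlift : FreeGroup.lift x = PresentedGroup.mk _ := FreeGroup.ext_hom _ _ fun i => by
      simp [x, PresentedGroup.of]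
    rw [hlift]
    exact PresentedGroup.one_of_mem ⟨k, hk, rfl⟩
  have hrel : t⁻¹ * wreathGen x f ^ r * t⁻¹⁻¹ = wreathGen x f ^ s := by
    rw [inv_inv, mul_assoc, inv_mul_eq_iff_eq_mul]
    exact (forall_lift_wordM_eq_one_iff x A (mul_sub_modEq_zero_of_map_y hνy)).1 hx
  have ht : t⁻¹ = RegularWreathProduct.inl (ν v) := by rw [hνv, map_inv]
  have ht_pow : t⁻¹ ^ p = 1 := by rw [ht, ← map_pow, ← map_pow, v_pow, map_one, map_one]
  let σ := BaumslagSolitarQuotient.lift (wreathGen x f) t⁻¹ hrel ht_pow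
  have hσ : RegularWreathProduct.rightHom.comp σ = ν :=
    hom_ext (by simp [σ, wreathGen, hνy]) (by simp [σ, ht])
  refine ⟨_, .of_wreath (σ := σ) (fun h => DFunLike.congr_fun hσ h) ?_, fun i => ?_⟩
  · rintro _ ⟨j, rfl⟩
    have hσv : σ v = RegularWreathProduct.inl (ν v) := by simp [σ, ht]
    change (σ (v ^ j)).left = 1
    rw [map_zpow, hσv, ← map_zpow, RegularWreathProduct.left_inl]
  · simp [σ, wreathGen, x]

/-- The generator `x_i` corresponds to the arrow `y` at the vertex `i`. -/
theorem nonempty_groupM_mulEquiv_cocycleGroup [NeZero n]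
    (hνy : ν y = Multiplicative.ofAdd (f : ZMod n))
    (hνv : ν v = (Multiplicative.ofAdd (A : ZMod n))⁻¹) :
    Nonempty (GroupM r n s f A ≃* CocycleGroup ν (Subgroup.zpowers v)) := by
  obtain ⟨φ, hφ, hφy⟩ := exists_isRelativeCocycle_groupM hνy hνv
  have huniv := CocycleGroup.isRelativeCocycle_of ν (Subgroup.zpowers v)
  let toCocycle : GroupM r n s f A →* CocycleGroup ν (Subgroup.zpowers v) :=
    PresentedGroup.toGroup (f := fun i => PresentedGroup.of (y, Multiplicative.ofAdd i)) <| by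
      rintro _ ⟨k, hk, rfl⟩
      exact lift_shift_wordM_eq_one_of_isRelativeCocycle hνy hνv huniv hk
  have htoCocycle (i : ZMod n) : toCocycle (PresentedGroup.of i) =
      PresentedGroup.of (y, Multiplicative.ofAdd i) := PresentedGroup.toGroup.of _
  refine ⟨MonoidHom.toMulEquiv toCocycle (CocycleGroup.lift hφ)
    (PresentedGroup.ext fun i => ?_) (PresentedGroup.ext fun ⟨h, z⟩ => ?_)⟩
  · rw [MonoidHom.comp_apply, htoCocycle, CocycleGroup.lift_of, hφy, MonoidHom.id_apply]
  · rw [MonoidHom.comp_apply, CocycleGroup.lift_of, MonoidHom.id_apply]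
    refine congrFun₂ ((hφ.comp toCocycle).ext_of_closure_eq_top huniv closure_y_v ?_) h z
    rintro g (rfl | rfl) z
    · rw [← ofAdd_toAdd z, hφy, htoCocycle]
    · rw [hφ.map_of_mem _ (Subgroup.mem_zpowers _), map_one,
        huniv.map_of_mem _ (Subgroup.mem_zpowers _)]

end BaumslagSolitar

section Beyl

namespace BeylGroup

variable {M N : ℕ} {R l : ℤ}

/-- The generator of the cyclic kernel. -/
def a : BeylGroup M N R l := PresentedGroup.of 0

/-- The generator that acts by conjugation. -/
def b : BeylGroup M N R l := PresentedGroup.of 1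

theorem a_pow : (a : BeylGroup M N R l) ^ M = 1 :=
  PresentedGroup.one_of_mem (Or.inl rfl)

theorem b_mul_a_mul_b_inv : (b : BeylGroup M N R l) * a * b⁻¹ = a ^ R :=
  PresentedGroup.mk_eq_mk_of_mul_inv_mem (Or.inr (Or.inl rfl))

theorem b_pow : (b : BeylGroup M N R l) ^ N = a ^ (l * ((M / Int.gcd M (R - 1) : ℕ) : ℤ)) :=
  PresentedGroup.mk_eq_mk_of_mul_inv_mem (Or.inr (Or.inr rfl))

theorem closure_a_b : Subgroup.closure {a, (b : BeylGroup M N R l)} = ⊤ := by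
  rw [← PresentedGroup.closure_range_of]
  congr 1
  ext g
  simp [Fin.exists_fin_two, a, b, eq_comm]

theorem isMetacyclic [NeZero M] : IsMetacyclic (BeylGroup M N R l) :=
  isMetacyclic_of_conj_mem closure_a_b (isOfFinOrder_iff_pow_eq_one.2 ⟨M, NeZero.pos M, a_pow⟩)
    ⟨R, b_mul_a_mul_b_inv.symm⟩

theorem card_dvd [NeZero M] : Nat.card (BeylGroup M N R l) ∣ M * N :=
  card_dvd_of_conj_mem closure_a_b a_pow ⟨R, b_mul_a_mul_b_inv.symm⟩ ⟨_, b_pow.symm⟩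

instance [NeZero M] [NeZero N] : Finite (BeylGroup M N R l) :=
  Nat.finite_of_card_ne_zero (ne_zero_of_dvd_ne_zero (NeZero.ne (M * N)) card_dvd)

theorem nonempty_mulEquiv_closure [NeZero M] [NeZero N] {X : Type*} [Group X] {x z : X}
    (hx : x ^ M = 1) (hxz : z * x * z⁻¹ = x ^ R)
    (hz : z ^ N = x ^ (l * ((M / Int.gcd M (R - 1) : ℕ) : ℤ)))
    (hcard : M * N ≤ Nat.card (Subgroup.closure {x, z})) :
    Nonempty (BeylGroup M N R l ≃* Subgroup.closure {x, z}) := by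
  let F : BeylGroup M N R l →* X := PresentedGroup.toGroup (f := ![x, z]) <| by
    rintro w (rfl | rfl | rfl)
    · simp [hx]
    · simp [hxz]
    · simp [hz]
  have hFa : F a = x := PresentedGroup.toGroup.of _
  have hFb : F b = z := PresentedGroup.toGroup.of _
  have hrange : F.range = Subgroup.closure {x, z} := by
    rw [MonoidHom.range_eq_map, ← closure_a_b, MonoidHom.map_closure, Set.image_pair, hFa, hFb]
  rw [← hrange] at hcard ⊢
  have hbij : Function.Bijective F.rangeRestrict :=
    F.rangeRestrict_surjective.bijective_of_nat_card_le <|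
      (Nat.le_of_dvd (NeZero.pos _) card_dvd).trans hcard
  exact ⟨MulEquiv.ofBijective _ hbij⟩

theorem nonempty_mulEquiv_multiplicative_zmod [NeZero M] (hR : R ≡ 1 [ZMOD M]) :
    Nonempty (BeylGroup M 1 R l ≃* Multiplicative (ZMod M)) := by
  let x : Multiplicative (ZMod M) := Multiplicative.ofAdd 1
  let z : Multiplicative (ZMod M) := x ^ (l * ((M / Int.gcd M (R - 1) : ℕ) : ℤ))
  have hx : x ^ M = 1 := by simp [x, ← ofAdd_nsmul]
  have hxz : z * x * z⁻¹ = x ^ R := by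
    rw [mul_inv_cancel_comm, zpow_eq_zpow_of_modEq hx hR, zpow_one]
  have htop : Subgroup.closure {x, z} = ⊤ := by
    refine eq_top_iff.2 fun q _ => ?_
    obtain ⟨i, hi⟩ := ZMod.intCast_surjective q.toAdd
    have hq : q = x ^ i := by simp [x, ← ofAdd_zsmul, hi]
    rw [hq]
    exact Subgroup.zpow_mem _ (Subgroup.subset_closure (Set.mem_insert x {z})) i
  obtain ⟨e⟩ := nonempty_mulEquiv_closure (N := 1) hx hxz (pow_one z) <| by
    rw [htop, Subgroup.card_top, Nat.card_congr Multiplicative.toAdd, Nat.card_zmod, mul_one]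
  exact ⟨e.trans ((MulEquiv.subgroupCongr htop).trans Subgroup.topEquiv)⟩

end BeylGroup

end Beyl

section Arithmetic

theorem sum_range_pow_pow_of_coprime {A : Type*} [Semiring A] {T : A} {N j : ℕ}
    (hT : T ^ N = 1) (hj : j.Coprime N) :
    ∑ t ∈ Finset.range N, (T ^ j) ^ t = ∑ t ∈ Finset.range N, T ^ t := by
  have hmap : Set.MapsTo (fun t => j * t % N) (Finset.range N) (Finset.range N) := fun t ht => by
    simpa using Nat.mod_lt _ (Nat.zero_lt_of_lt (Finset.mem_range.1 ht))
  have hinj : Set.InjOn (fun t => j * t % N) (Finset.range N) := fun a ha b hb hab =>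
    (Nat.ModEq.cancel_left_of_coprime (c := j) (Nat.gcd_comm N j ▸ hj) hab).eq_of_lt_of_lt
      (Finset.mem_range.1 ha) (Finset.mem_range.1 hb)
  refine Finset.sum_nbij (fun t => j * t % N) hmap hinj
    (Finset.surjOn_of_injOn_of_card_le _ hmap hinj le_rfl) fun t _ => ?_
  rw [← pow_mul, pow_eq_pow_mod (j * t) hT]

theorem sum_range_mul_pow_of_mul_eq_one {A : Type*} [CommSemiring A] {ρ σ : A} (h : ρ * σ = 1)
    (ς : A) (N : ℕ) :
    ∑ t ∈ Finset.range N, (ς * σ) ^ t =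
      σ ^ (N - 1) * ∑ t ∈ Finset.range N, ς ^ t * ρ ^ (N - 1 - t) := by
  rw [Finset.mul_sum]
  refine Finset.sum_congr rfl fun t ht => ?_
  obtain ⟨q, hq⟩ : ∃ q, N - 1 = q + t := ⟨N - 1 - t, by have := Finset.mem_range.1 ht; omega⟩
  have hinv : ρ ^ q * σ ^ q = 1 := by rw [← mul_pow, h, one_pow]
  calc (ς * σ) ^ t = ς ^ t * σ ^ t * (ρ ^ q * σ ^ q) := by rw [hinv, mul_one, mul_pow]
    _ = σ ^ (N - 1) * (ς ^ t * ρ ^ (N - 1 - t)) := by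
      rw [hq, Nat.add_sub_cancel, pow_add]
      ring

theorem gcd_eq_gcd_of_modEq {M x y : ℤ} (h : x ≡ y [ZMOD M]) : Int.gcd M x = Int.gcd M y := by
  obtain ⟨w, hw⟩ := h.dvd
  rw [← sub_add_cancel y x, hw, add_comm, Int.gcd_add_mul_left_right]

theorem modEq_natAbs_sub (x y : ℤ) : x ≡ y [ZMOD (x - y).natAbs] :=
  (Int.modEq_iff_dvd.2 (Int.natAbs_dvd.2 dvd_rfl)).symm

theorem mul_pow_modEq_one {M r s t : ℤ} {p : ℕ} (hrs : r ^ p ≡ s ^ p [ZMOD M])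
    (ht : r * t ≡ 1 [ZMOD M]) : (s * t) ^ p ≡ 1 [ZMOD M] := by
  calc (s * t) ^ p = s ^ p * t ^ p := mul_pow s t p
    _ ≡ r ^ p * t ^ p [ZMOD M] := hrs.symm.mul_right _
    _ = (r * t) ^ p := (mul_pow r t p).symm
    _ ≡ 1 [ZMOD M] := by simpa using ht.pow p

theorem gcd_pow_sub_one_of_coprime {M : ℕ} {T : ℤ} {N j : ℕ} (hT : T ^ N ≡ 1 [ZMOD M])
    (hj : j.Coprime N) : Int.gcd M (T ^ j - 1) = Int.gcd M (T - 1) := by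
  have hTN : (T : ZMod M) ^ N = 1 := by
    rw [← Int.cast_pow, (ZMod.intCast_eq_intCast_iff _ _ _).2 hT, Int.cast_one]
  obtain ⟨i, hi⟩ := exists_pow_eq_self_of_coprime
    (Nat.Coprime.coprime_dvd_right (orderOf_dvd_of_pow_eq_one hTN) hj)
  have hT' : (T ^ j) ^ i - 1 ≡ T - 1 [ZMOD M] :=
    ((ZMod.intCast_eq_intCast_iff _ _ _).1 (by exact_mod_cast hi)).sub_right 1
  apply Nat.dvd_antisymm
  · calc Int.gcd M (T ^ j - 1) ∣ Int.gcd M ((T ^ j) ^ i - 1) :=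
          Int.gcd_dvd_gcd_of_dvd_right _ (sub_one_dvd_pow_sub_one _ _)
      _ = Int.gcd M (T - 1) := gcd_eq_gcd_of_modEq hT'
  · exact Int.gcd_dvd_gcd_of_dvd_right _ (sub_one_dvd_pow_sub_one _ _)

theorem gcd_mul_sub_one_of_mul_modEq_one {M ρ σ : ℤ} (h : ρ * σ ≡ 1 [ZMOD M]) (ς : ℤ) :
    Int.gcd M (ς * σ - 1) = Int.gcd M (ρ - ς) := by
  have hcop : Int.gcd M ρ = 1 := by
    obtain ⟨w, hw⟩ := h.dvd
    exact Int.isCoprime_iff_gcd_eq_one.1 ⟨w, σ, by linear_combination -hw⟩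
  have hmod : (ς * σ - 1) * ρ ≡ ς - ρ [ZMOD M] := by
    convert (h.mul_left ς).sub_right ρ using 1 <;> ring
  calc Int.gcd M (ς * σ - 1) = Int.gcd M ((ς * σ - 1) * ρ) :=
        (Int.gcd_mul_left_right_of_gcd_eq_one hcop).symm
    _ = Int.gcd M (ς - ρ) := gcd_eq_gcd_of_modEq hmod
    _ = Int.gcd M (ρ - ς) := by rw [← Int.gcd_neg, neg_sub]

theorem sum_range_pow_mul_pow_modEq {m ρ ς : ℤ} (h : m ∣ ρ - ς) (N : ℕ) :
    ∑ t ∈ Finset.range N, ς ^ t * ρ ^ (N - 1 - t) ≡ N * ρ ^ (N - 1) [ZMOD m] := by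
  have hterm (t : ℕ) (ht : t ∈ Finset.range N) :
      ς ^ t * ρ ^ (N - 1 - t) ≡ ρ ^ (N - 1) [ZMOD m] := by
    obtain ⟨q, hq⟩ : ∃ q, N - 1 = t + q := ⟨N - 1 - t, by have := Finset.mem_range.1 ht; omega⟩
    rw [hq, Nat.add_sub_cancel_left, pow_add]
    exact ((Int.modEq_iff_dvd.2 h).pow t).mul_right _
  simpa using Int.ModEq.sum hterm

theorem exists_sum_range_pow_mul_pow_eq_mul {ρ ς : ℤ} (hco : IsCoprime ρ ς) {k N : ℕ}
    (hk : (k * N : ℤ) ∣ ρ - ς) :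
    ∃ Q : ℤ, ∑ t ∈ Finset.range N, ς ^ t * ρ ^ (N - 1 - t) = N * Q ∧ IsCoprime (k : ℤ) Q := by
  obtain ⟨c, hc⟩ := (sum_range_pow_mul_pow_modEq hk N).symm.dvd
  have hkρ : IsCoprime (k : ℤ) ρ := by
    have hsub : IsCoprime (ρ - ς) ρ := by
      obtain ⟨x, y, hxy⟩ := hco
      exact ⟨-y, x + y, by linear_combination hxy⟩
    exact hsub.of_isCoprime_of_dvd_left ((Dvd.intro _ rfl).trans hk)
  exact ⟨ρ ^ (N - 1) + k * c, by linear_combination hc,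
    IsCoprime.add_mul_left_right hkρ.pow_right c⟩

variable {ρ ς σ : ℤ} {k N M j : ℕ}

theorem div_gcd_eq_natAbs {e Q : ℤ} (hM : M = (e * N * Q).natAbs) (hM0 : M ≠ 0)
    (hQ : IsCoprime (k : ℤ) Q) : M / Int.gcd M (k * N * e) = Q.natAbs := by
  have hgcd : Int.gcd M (k * N * e) = (e * N).natAbs := by
    rw [hM, Int.gcd_eq_natAbs_gcd_natAbs, Int.natAbs_natCast, ← Int.gcd_eq_natAbs_gcd_natAbs,
      show (k * N * e : ℤ) = e * N * k by ring, Int.gcd_mul_left,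
      Int.isCoprime_iff_gcd_eq_one.1 hQ.symm, mul_one]
  rw [Int.natAbs_mul] at hM
  rw [hgcd, hM, Nat.mul_div_cancel_left _ (Nat.pos_of_ne_zero (left_ne_zero_of_mul (hM ▸ hM0)))]

/-- The norm `1 + T + ⋯ + T ^ (N - 1)` of `T = (ς / ρ) ^ j` is `N M / (M, T - 1)` up to a unit. -/
theorem exists_sum_range_pow_modEq [NeZero k] [NeZero N] [NeZero M] (hco : IsCoprime ρ ς)
    (hk : (k * N : ℤ) ∣ ρ - ς) (hμ : k * N * M = (ρ ^ N - ς ^ N).natAbs)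
    (hσ : ρ * σ ≡ 1 [ZMOD (k * N * M : ℕ)]) (hj : j.Coprime N) :
    ∃ c : ℤ, IsCoprime c M ∧ ∑ t ∈ Finset.range N, ((ς * σ) ^ j) ^ t ≡
      N * (c * ((M / Int.gcd M ((ς * σ) ^ j - 1) : ℕ) : ℤ)) [ZMOD (k * N * M : ℕ)] := by
  have hMμ : (M : ℤ) ∣ (k * N * M : ℕ) := Int.natCast_dvd_natCast.2 (Dvd.intro_left _ rfl)
  have hT : (ς * σ) ^ N ≡ 1 [ZMOD (k * N * M : ℕ)] :=
    mul_pow_modEq_one (hμ ▸ modEq_natAbs_sub _ _) hσ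
  obtain ⟨Q, hQ, hkQ⟩ := exists_sum_range_pow_mul_pow_eq_mul hco hk
  obtain ⟨e, he⟩ := hk
  have hMQ : M = (e * N * Q).natAbs := by
    have hgeom : ρ ^ N - ς ^ N = (k * N : ℕ) * (e * N * Q) := by
      have := geom_sum₂_mul ς ρ N
      rw [hQ] at this
      push_cast
      linear_combination (N * Q : ℤ) * he + this
    rw [hgeom, Int.natAbs_mul, Int.natAbs_natCast] at hμ
    exact Nat.eq_of_mul_eq_mul_left (NeZero.pos _) hμ
  have hdiv : M / Int.gcd M ((ς * σ) ^ j - 1) = Q.natAbs := by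
    rw [gcd_pow_sub_one_of_coprime (hT.of_dvd hMμ) hj,
      gcd_mul_sub_one_of_mul_modEq_one (hσ.of_dvd hMμ), he, div_gcd_eq_natAbs hMQ (NeZero.ne M) hkQ]
  have hsum : ∑ t ∈ Finset.range N, ((ς * σ) ^ j) ^ t ≡ σ ^ (N - 1) * (N * Q)
      [ZMOD (k * N * M : ℕ)] := by
    rw [← ZMod.intCast_eq_intCast_iff] at hσ hT ⊢
    push_cast at hσ hT ⊢
    rw [sum_range_pow_pow_of_coprime hT hj, sum_range_mul_pow_of_mul_eq_one hσ]
    exact_mod_cast congrArg (fun q : ℤ => ((σ ^ (N - 1) * q : ℤ) : ZMod (k * N * M))) hQ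
  have hσM : IsCoprime σ (M : ℤ) := by
    obtain ⟨w, hw⟩ := (hσ.of_dvd hMμ).dvd
    exact ⟨ρ, w, by linear_combination -hw⟩
  have hsign : IsUnit Q.sign := by
    have hQ0 : Q ≠ 0 := by
      rintro rfl
      exact NeZero.ne M (by simpa using hMQ)
    exact Int.isUnit_iff_natAbs_eq.2 (Int.natAbs_sign_of_ne_zero hQ0)
  refine ⟨σ ^ (N - 1) * Q.sign, (isCoprime_mul_unit_right_left hsign _ _).2 hσM.pow_left, ?_⟩
  rw [hdiv, show N * (σ ^ (N - 1) * Q.sign * Q.natAbs) = σ ^ (N - 1) * (N * (Q.sign * Q.natAbs)) by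
    ring, Int.sign_mul_natAbs]
  exact hsum

theorem intCast_powMod {m : ℕ} {u : (ZMod m)ˣ} {b : ℤ} (hb : (u : ZMod m) = b) (i : ℤ) :
    (powMod m b i : ZMod m) = ((u ^ i : (ZMod m)ˣ) : ZMod m) := by
  cases i with
  | ofNat i => simp [powMod, hb]
  | negSucc i =>
    have hcop : Int.gcd b m = 1 := Int.isCoprime_iff_gcd_eq_one.1
      ((ZMod.coe_int_isUnit_iff_isCoprime b m).1 (hb ▸ u.isUnit)).symm
    have hinv : (Int.gcdA b m : ZMod m) = ((u⁻¹ : (ZMod m)ˣ) : ZMod m) := by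
      have hbezout := congrArg (Int.cast : ℤ → ZMod m) (Int.gcd_eq_gcd_ab b m)
      rw [hcop] at hbezout
      exact (Units.inv_eq_of_mul_eq_one_right (by simpa [hb] using hbezout.symm)).symm
    rw [zpow_negSucc, ← inv_pow, Units.val_pow_eq_pow_val, ← hinv, powMod, Int.cast_pow]

end Arithmetic

section BaumslagSolitarOrder

namespace BaumslagSolitarQuotient

variable {r s rhat : ℤ} {p : ℕ}

theorem y_pow_natAbs :
    (y : BaumslagSolitarQuotient r s p) ^ (r ^ p - s ^ p).natAbs = 1 := by
  have hconj := pow_mul_zpow_mul_pow_inv (v_mul_y_zpow_mul_v_inv (r := r) (s := s) (p := p)) p 1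
  rw [v_pow, one_mul, inv_one, mul_one, mul_one, mul_one] at hconj
  rw [← orderOf_dvd_iff_pow_eq_one, ← Int.natCast_dvd, orderOf_dvd_iff_zpow_eq_one, zpow_sub,
    hconj, mul_inv_cancel]

theorem v_mul_y_mul_v_inv (hrhat : r * rhat ≡ 1 [ZMOD (r ^ p - s ^ p).natAbs]) :
    (v : BaumslagSolitarQuotient r s p) * y * v⁻¹ = y ^ (s * rhat) := by
  calc v * y * v⁻¹ = (v * y ^ r * v⁻¹) ^ rhat := by
        rw [conj_zpow, ← zpow_mul, zpow_eq_zpow_of_modEq y_pow_natAbs hrhat, zpow_one]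
    _ = y ^ (s * rhat) := by rw [v_mul_y_zpow_mul_v_inv, zpow_mul]

theorem exists_zpow_mul_zpow (hμ : (r ^ p - s ^ p).natAbs ≠ 0)
    (hrhat : r * rhat ≡ 1 [ZMOD (r ^ p - s ^ p).natAbs]) (h : BaumslagSolitarQuotient r s p) :
    ∃ z x : ℤ, h = y ^ z * v ^ x :=
  _root_.exists_zpow_mul_zpow closure_y_v
    (isOfFinOrder_iff_pow_eq_one.2 ⟨_, Nat.pos_of_ne_zero hμ, y_pow_natAbs⟩)
    ⟨_, (v_mul_y_mul_v_inv hrhat).symm⟩ h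

/-- The action on the integers modulo `|r ^ p - s ^ p|` in which `y` is the translation by `1` and
`v` is the multiplication by `s / r`. -/
theorem exists_toPerm [NeZero p] (hrhat : r * rhat ≡ 1 [ZMOD (r ^ p - s ^ p).natAbs]) :
    ∃ F : BaumslagSolitarQuotient r s p →* Equiv.Perm (ZMod (r ^ p - s ^ p).natAbs),
      F y = Equiv.addRight 1 := by
  set μ := (r ^ p - s ^ p).natAbs
  have hT : ((s * rhat : ℤ) : ZMod μ) ^ p = 1 := by
    exact_mod_cast (ZMod.intCast_eq_intCast_iff _ _ _).2
      (mul_pow_modEq_one (modEq_natAbs_sub _ _) hrhat)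
  let u : (ZMod μ)ˣ := Units.ofPowEqOne (s * rhat : ℤ) p hT (NeZero.ne p)
  have hu : (u : ZMod μ) * r = s := by
    have hinv := (ZMod.intCast_eq_intCast_iff _ _ _).2 hrhat
    push_cast at hinv
    change ((s * rhat : ℤ) : ZMod μ) * r = s
    push_cast
    linear_combination (s : ZMod μ) * hinv
  let v' : Equiv.Perm (ZMod μ) := MulAction.toPermHom (ZMod μ)ˣ (ZMod μ) u
  let y' : Equiv.Perm (ZMod μ) := Equiv.addRight 1
  have hy' (z : ℤ) (x : ZMod μ) : (y' ^ z) x = x + z := by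
    simp [y']
  have hrel : v' * y' ^ r * v'⁻¹ = y' ^ s := by
    rw [mul_inv_eq_iff_eq_mul]
    ext x : 1
    simp only [Equiv.Perm.mul_apply, hy']
    change u • (x + (r : ZMod μ)) = u • x + (s : ZMod μ)
    rw [smul_add, Units.smul_def u (r : ZMod μ), smul_eq_mul, hu]
  exact ⟨lift y' v' hrel (by rw [← map_pow, Units.pow_ofPowEqOne, map_one]), lift_y⟩

theorem natAbs_dvd_orderOf_y [NeZero p] (hrhat : r * rhat ≡ 1 [ZMOD (r ^ p - s ^ p).natAbs]) :
    (r ^ p - s ^ p).natAbs ∣ orderOf (y : BaumslagSolitarQuotient r s p) := by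
  obtain ⟨F, hF⟩ := exists_toPerm hrhat
  have hpow : (F y ^ orderOf (y : BaumslagSolitarQuotient r s p)) 0 = 0 := by
    rw [← map_pow, pow_orderOf_eq_one, map_one, Equiv.Perm.one_apply]
  rw [← ZMod.natCast_eq_zero_iff]
  simpa [hF] using hpow

theorem dvd_index_zpowers_y : p ∣ (Subgroup.zpowers (y : BaumslagSolitarQuotient r s p)).index := by
  let F : BaumslagSolitarQuotient r s p →* Multiplicative (ZMod p) :=
    lift 1 (Multiplicative.ofAdd 1) (by simp) (by simp [← ofAdd_nsmul])
  have hF : Function.Surjective F := fun q => by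
    obtain ⟨z, hz⟩ := ZMod.intCast_surjective q.toAdd
    exact ⟨v ^ z, by simp [F, ← ofAdd_zsmul, hz]⟩
  have hy : Subgroup.zpowers y ≤ F.ker := by
    rw [Subgroup.zpowers_le, MonoidHom.mem_ker, lift_y]
  have hindex : F.ker.index = p := by
    rw [Subgroup.index_ker, MonoidHom.range_eq_top.2 hF, Subgroup.card_top,
      Nat.card_congr Multiplicative.toAdd, Nat.card_zmod]
  exact hindex.symm.dvd.trans (Subgroup.index_dvd_of_le hy)

theorem card_eq [NeZero p] (hμ : (r ^ p - s ^ p).natAbs ≠ 0)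
    (hrhat : r * rhat ≡ 1 [ZMOD (r ^ p - s ^ p).natAbs]) :
    Nat.card (BaumslagSolitarQuotient r s p) = (r ^ p - s ^ p).natAbs * p := by
  have : NeZero (r ^ p - s ^ p).natAbs := ⟨hμ⟩
  apply Nat.dvd_antisymm
  · exact card_dvd_of_conj_mem closure_y_v y_pow_natAbs ⟨_, (v_mul_y_mul_v_inv hrhat).symm⟩
      (v_pow ▸ Subgroup.one_mem _)
  · rw [← (Subgroup.zpowers y).card_mul_index, Nat.card_zpowers]
    exact mul_dvd_mul (natAbs_dvd_orderOf_y hrhat) dvd_index_zpowers_y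

end BaumslagSolitarQuotient

end BaumslagSolitarOrder

section Index

open BaumslagSolitarQuotient

variable {n : ℕ}

theorem index_eq_of_forall_ofAdd_mem_iff {D : Subgroup (Multiplicative (ZMod n))} {g : ℕ}
    (hD : ∀ x : ℤ, Multiplicative.ofAdd (x : ZMod n) ∈ D ↔ (g : ℤ) ∣ x) : D.index = g := by
  have hsurj : Function.Surjective (Int.castAddHom (ZMod n)) := ZMod.intCast_surjective
  have hcomap : (Subgroup.toAddSubgroup' D).comap (Int.castAddHom (ZMod n)) =
      AddSubgroup.zmultiples (g : ℤ) := by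
    ext x
    rw [Int.mem_zmultiples_iff]
    exact hD x
  calc D.index = (Subgroup.toAddSubgroup' D).index := rfl
    _ = g := by
      rw [← AddSubgroup.index_comap_of_surjective _ hsurj, hcomap, Int.index_zmultiples,
        Int.natAbs_natCast]

theorem ofAdd_intCast_mem_closure_pair_iff (A f x : ℤ) :
    Multiplicative.ofAdd (x : ZMod n) ∈ Subgroup.closure
        {Multiplicative.ofAdd (A : ZMod n), Multiplicative.ofAdd (f : ZMod n)} ↔
      ((Int.gcd (Int.gcd n A) f : ℕ) : ℤ) ∣ x := by
  have hmem : Multiplicative.ofAdd (x : ZMod n) ∈ Subgroup.closure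
      {Multiplicative.ofAdd (A : ZMod n), Multiplicative.ofAdd (f : ZMod n)} ↔
      ∃ a b : ℤ, (n : ℤ) ∣ x - (a * A + b * f) := by
    simp only [Subgroup.mem_closure_pair, ← ofAdd_zsmul, ← ofAdd_add,
      Multiplicative.ofAdd.injective.eq_iff, zsmul_eq_mul, ← Int.cast_mul, ← Int.cast_add,
      ZMod.intCast_eq_intCast_iff_dvd_sub]
  rw [hmem]
  constructor
  · rintro ⟨a, b, hx⟩
    have hA : ((Int.gcd (Int.gcd n A) f : ℕ) : ℤ) ∣ a * A :=
      ((Int.gcd_dvd_left ..).trans (Int.gcd_dvd_right ..)).mul_left a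
    have hf : ((Int.gcd (Int.gcd n A) f : ℕ) : ℤ) ∣ b * f := (Int.gcd_dvd_right ..).mul_left b
    have hn : ((Int.gcd (Int.gcd n A) f : ℕ) : ℤ) ∣ n :=
      (Int.gcd_dvd_left ..).trans (Int.gcd_dvd_left ..)
    exact (dvd_sub_left (dvd_add hA hf)).1 (hn.trans hx)
  · rintro ⟨c, rfl⟩
    have hfst := Int.gcd_eq_gcd_ab n A
    have hsnd := Int.gcd_eq_gcd_ab (Int.gcd n A) f
    refine ⟨c * Int.gcdA (Int.gcd n A) f * Int.gcdB n A, c * Int.gcdB (Int.gcd n A) f,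
      c * Int.gcdA (Int.gcd n A) f * Int.gcdA n A, ?_⟩
    linear_combination c * hsnd + c * Int.gcdA (Int.gcd n A) f * hfst

theorem index_closure_pair_ofAdd (A f : ℤ) :
    (Subgroup.closure {Multiplicative.ofAdd (A : ZMod n), Multiplicative.ofAdd (f : ZMod n)}).index
      = Int.gcd (Int.gcd n A) f :=
  index_eq_of_forall_ofAdd_mem_iff (ofAdd_intCast_mem_closure_pair_iff A f)

variable {r s f A : ℤ} {p : ℕ} {ν : BaumslagSolitarQuotient r s p →* Multiplicative (ZMod n)}

theorem index_range_eq_gcd (hνy : ν y = Multiplicative.ofAdd (f : ZMod n))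
    (hνv : ν v = (Multiplicative.ofAdd (A : ZMod n))⁻¹) :
    ν.range.index = Int.gcd (Int.gcd n A) f := by
  rw [← ofAdd_neg, ← Int.cast_neg] at hνv
  rw [MonoidHom.range_eq_map, ← closure_y_v, MonoidHom.map_closure, Set.image_pair, hνy, hνv,
    Set.pair_comm, index_closure_pair_ofAdd, Int.gcd_neg]

theorem index_map_zpowers_v_eq_gcd (hνv : ν v = (Multiplicative.ofAdd (A : ZMod n))⁻¹) :
    ((Subgroup.zpowers v).map ν).index = Int.gcd n A := by
  have hindex := index_closure_pair_ofAdd (n := n) A 0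
  rwa [Int.cast_zero, ofAdd_zero, Set.pair_comm, Subgroup.closure_insert_one,
    ← Subgroup.zpowers_eq_closure, Int.gcd_zero_right, Int.natAbs_natCast, ← Subgroup.zpowers_inv,
    ← hνv, ← MonoidHom.map_zpowers] at hindex

theorem map_zpow_mul_zpow_eq_one_iff (hνy : ν y = Multiplicative.ofAdd (f : ZMod n))
    (hνv : ν v = (Multiplicative.ofAdd (A : ZMod n))⁻¹) (z x : ℤ) :
    ν (y ^ z * v ^ x) = 1 ↔ (n : ℤ) ∣ z * f - x * A := by
  rw [map_mul, map_zpow, map_zpow, hνy, hνv, inv_zpow, ← ofAdd_zsmul, ← ofAdd_zsmul,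
    mul_inv_eq_one, Multiplicative.ofAdd.injective.eq_iff, zsmul_eq_mul, zsmul_eq_mul,
    ← Int.cast_mul, ← Int.cast_mul, ZMod.intCast_eq_intCast_iff_dvd_sub, dvd_sub_comm]

theorem exists_hom_multiplicative_zmod (hf : f * (r - s) ≡ 0 [ZMOD n]) (hA : (n : ℤ) ∣ p * A) :
    ∃ ν : BaumslagSolitarQuotient r s p →* Multiplicative (ZMod n),
      ν y = Multiplicative.ofAdd (f : ZMod n) ∧ ν v = (Multiplicative.ofAdd (A : ZMod n))⁻¹ := by
  refine ⟨lift (Multiplicative.ofAdd (f : ZMod n)) (Multiplicative.ofAdd (A : ZMod n))⁻¹ ?_ ?_,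
    lift_y, lift_v⟩
  · rw [inv_inv, mul_assoc, inv_mul_eq_iff_eq_mul, mul_comm]
    rw [← ZMod.intCast_eq_intCast_iff] at hf
    push_cast at hf
    rw [mul_right_inj, ← ofAdd_zsmul, ← ofAdd_zsmul, zsmul_eq_mul, zsmul_eq_mul]
    congr 1
    linear_combination hf
  · rw [inv_pow, ← ofAdd_nsmul, nsmul_eq_mul, inv_eq_one, ← ofAdd_zero,
      Multiplicative.ofAdd.injective.eq_iff, ← Int.cast_natCast, ← Int.cast_mul,
      ZMod.intCast_zmod_eq_zero_iff_dvd]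
    exact hA

theorem disjoint_ker_zpowers_v (hνv : ν v = (Multiplicative.ofAdd (A : ZMod n))⁻¹)
    (hA : ∀ x : ℤ, (n : ℤ) ∣ x * A → (p : ℤ) ∣ x) : Disjoint ν.ker (Subgroup.zpowers v) := by
  rw [Subgroup.disjoint_def]
  rintro _ hker ⟨x, rfl⟩
  have hx : (n : ℤ) ∣ x * A := by
    rwa [MonoidHom.mem_ker, map_zpow, hνv, inv_zpow, inv_eq_one, ← ofAdd_zsmul, ← ofAdd_zero,
      Multiplicative.ofAdd.injective.eq_iff, zsmul_eq_mul, ← Int.cast_mul,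
      ZMod.intCast_zmod_eq_zero_iff_dvd] at hker
  exact orderOf_dvd_iff_zpow_eq_one.1
    ((Int.natCast_dvd_natCast.2 (orderOf_dvd_of_pow_eq_one v_pow)).trans (hA x hx))

end Index

section Kernel

open BaumslagSolitarQuotient

variable {r s rhat f α c R : ℤ} {k d N M j : ℕ}

section

variable {G : Type*} [Group G] {ν : BaumslagSolitarQuotient r s (d * N) →* G}

theorem y_zpow_mem_ker_iff [NeZero d] (hf : IsCoprime f (k * N : ℤ))
    (hν : ∀ z x : ℤ, y ^ z * v ^ x ∈ ν.ker ↔ (k * d * N : ℤ) ∣ z * (d * f) - x * (k * α)) (z : ℤ) :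
    y ^ z ∈ ν.ker ↔ (k * N : ℤ) ∣ z := by
  have hz := hν z 0
  rw [zpow_zero, mul_one, show z * (d * f) - 0 * (k * α) = d * (z * f) by ring,
    show (k * d * N : ℤ) = d * (k * N) by ring,
    mul_dvd_mul_iff_left (Int.natCast_ne_zero.2 (NeZero.ne d))] at hz
  exact hz.trans ⟨hf.symm.dvd_of_dvd_mul_right, fun h => h.mul_right f⟩

theorem y_zpow_mul_v_pow_mem_ker (hj : j * α ≡ f [ZMOD N])
    (hν : ∀ z x : ℤ, y ^ z * v ^ x ∈ ν.ker ↔ (k * d * N : ℤ) ∣ z * (d * f) - x * (k * α)) :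
    y ^ (k : ℤ) * v ^ (d * j) ∈ ν.ker := by
  obtain ⟨w, hw⟩ := hj.dvd
  rw [← zpow_natCast v, hν]
  refine ⟨w, ?_⟩
  push_cast
  linear_combination (k * d : ℤ) * hw

theorem dvd_of_y_zpow_mul_v_zpow_mem_ker (hkd : IsCoprime (k : ℤ) d) (hα : IsCoprime α d)
    (hν : ∀ z x : ℤ, y ^ z * v ^ x ∈ ν.ker ↔ (k * d * N : ℤ) ∣ z * (d * f) - x * (k * α))
    {z x : ℤ} (h : y ^ z * v ^ x ∈ ν.ker) : (d : ℤ) ∣ x := by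
  obtain ⟨w, hw⟩ := (hν z x).1 h
  exact (hkd.symm.mul_right hα.symm).dvd_of_dvd_mul_right
    ⟨z * f - k * N * w, by linear_combination -hw⟩

theorem exists_div_zpow_eq_y_zpow (hμ : (r ^ (d * N) - s ^ (d * N)).natAbs ≠ 0)
    (hrhat : r * rhat ≡ 1 [ZMOD (r ^ (d * N) - s ^ (d * N)).natAbs]) (hj : j.Coprime N)
    (k z x : ℤ) : ∃ t w : ℤ, (y ^ z * v ^ (d * x)) / (y ^ k * v ^ (d * j)) ^ t =
      (y ^ w : BaumslagSolitarQuotient r s (d * N)) := by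
  have := normal_zpowers_of_conj_mem closure_y_v
    (isOfFinOrder_iff_pow_eq_one.2 ⟨_, Nat.pos_of_ne_zero hμ, y_pow_natAbs⟩)
    ⟨_, (v_mul_y_mul_v_inv hrhat).symm⟩
  obtain ⟨t, w, htw⟩ := Nat.isCoprime_iff_coprime.2 hj
  have hv : (v : BaumslagSolitarQuotient r s (d * N)) ^ (d * x : ℤ) = (v ^ (d * j)) ^ (t * x) := by
    rw [← zpow_natCast v, ← zpow_mul]
    refine zpow_eq_zpow_of_modEq v_pow (Int.modEq_iff_dvd.2 ⟨-(w * x), ?_⟩)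
    push_cast
    linear_combination (d * x : ℤ) * htw
  have hy : ((y : BaumslagSolitarQuotient r s (d * N)) :
      BaumslagSolitarQuotient r s (d * N) ⧸ Subgroup.zpowers y) = 1 :=
    (QuotientGroup.eq_one_iff y).2 (Subgroup.mem_zpowers y)
  have hmem : (y ^ z * v ^ (d * x)) / (y ^ k * v ^ (d * j)) ^ (t * x) ∈
      Subgroup.zpowers (y : BaumslagSolitarQuotient r s (d * N)) := by
    rw [hv, ← QuotientGroup.eq_one_iff]
    simp only [QuotientGroup.mk_div, QuotientGroup.mk_mul, QuotientGroup.mk_zpow, hy, one_zpow,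
      one_mul, div_self']
  obtain ⟨w', hw'⟩ := hmem
  exact ⟨t * x, w', hw'.symm⟩

theorem ker_eq_closure_pair [NeZero d] (hμ : k * N * M = (r ^ (d * N) - s ^ (d * N)).natAbs)
    (hμ0 : (r ^ (d * N) - s ^ (d * N)).natAbs ≠ 0)
    (hrhat : r * rhat ≡ 1 [ZMOD (r ^ (d * N) - s ^ (d * N)).natAbs])
    (hf : IsCoprime f (k * N : ℤ)) (hα : IsCoprime α d) (hkd : IsCoprime (k : ℤ) d)
    (hj : j.Coprime N) (hjα : j * α ≡ f [ZMOD N]) (hc : IsCoprime c M)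
    (hν : ∀ z x : ℤ, y ^ z * v ^ x ∈ ν.ker ↔ (k * d * N : ℤ) ∣ z * (d * f) - x * (k * α)) :
    ν.ker = Subgroup.closure {y ^ (k * N * c : ℤ), y ^ (k : ℤ) * v ^ (d * j)} := by
  set b := y ^ (k : ℤ) * (v : BaumslagSolitarQuotient r s (d * N)) ^ (d * j) with hb_def
  have hb : b ∈ ν.ker := y_zpow_mul_v_pow_mem_ker hjα hν
  have hy := y_zpow_mem_ker_iff hf hν
  apply le_antisymm
  · intro h hh
    obtain ⟨z, x, rfl⟩ := exists_zpow_mul_zpow hμ0 hrhat h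
    obtain ⟨x, rfl⟩ := dvd_of_y_zpow_mul_v_zpow_mem_ker hkd hα hν hh
    obtain ⟨t, w, hw⟩ := exists_div_zpow_eq_y_zpow hμ0 hrhat hj k z x
    rw [← hb_def] at hw
    have hwker : y ^ w ∈ ν.ker := hw ▸ div_mem hh (zpow_mem hb t)
    obtain ⟨i, rfl⟩ := (hy w).1 hwker
    have hpow := zpow_mem_zpowers_zpow_of_isCoprime (m := k * N) (M := M) (hμ ▸ y_pow_natAbs) hc i
    rw [Nat.cast_mul] at hpow
    rw [div_eq_iff_eq_mul.1 hw]
    exact mul_mem (Subgroup.zpowers_le.2 (Subgroup.subset_closure (Set.mem_insert _ _)) hpow)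
      (zpow_mem (Subgroup.subset_closure (Set.mem_insert_of_mem _ (Set.mem_singleton b))) t)
  · rw [Subgroup.closure_le]
    rintro _ (rfl | rfl)
    · exact (hy _).2 (Dvd.intro _ rfl)
    · exact hb

end

theorem v_pow_mul_y_mul_v_pow_inv
    (hrhat : r * rhat ≡ 1 [ZMOD (r ^ (d * N) - s ^ (d * N)).natAbs]) :
    v ^ (d * j) * y * (v ^ (d * j))⁻¹ =
      (y : BaumslagSolitarQuotient r s (d * N)) ^ ((s * rhat) ^ (d * j)) := by
  have hconj := v_mul_y_mul_v_inv hrhat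
  nth_rw 1 [← zpow_one y] at hconj
  simpa only [one_pow, one_mul, mul_one, zpow_one] using pow_mul_zpow_mul_pow_inv hconj (d * j) 1

theorem exists_y_zpow_mul_v_pow_pow_eq [NeZero k] [NeZero N] [NeZero M] (hrs : IsCoprime r s)
    (hk : (k * N : ℤ) ∣ r - s) (hμ : k * N * M = (r ^ (d * N) - s ^ (d * N)).natAbs)
    (hrhat : r * rhat ≡ 1 [ZMOD (r ^ (d * N) - s ^ (d * N)).natAbs]) (hj : j.Coprime N) :
    ∃ c : ℤ, IsCoprime c M ∧
      (y ^ (k : ℤ) * (v : BaumslagSolitarQuotient r s (d * N)) ^ (d * j)) ^ N =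
        (y ^ (k * N * c : ℤ)) ^ ((M / Int.gcd M ((s * rhat) ^ (d * j) - 1) : ℕ) : ℤ) := by
  obtain ⟨c, hcM, hc⟩ := exists_sum_range_pow_modEq (ρ := r ^ d) (ς := s ^ d) (σ := rhat ^ d)
    hrs.pow (hk.trans (sub_dvd_pow_sub_pow r s d)) (by rw [hμ, pow_mul, pow_mul])
    (by rw [← mul_pow, hμ]; simpa only [one_pow] using hrhat.pow d) hj
  rw [← mul_pow, ← pow_mul] at hc
  refine ⟨c, hcM, ?_⟩
  rw [zpow_mul_pow (v_pow_mul_y_mul_v_pow_inv hrhat), ← pow_mul v, mul_right_comm d, pow_mul v,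
    v_pow, one_pow, mul_one, ← zpow_mul]
  refine zpow_eq_zpow_of_modEq y_pow_natAbs ?_
  rw [← hμ]
  convert hc.mul_left k using 1
  ring

theorem nonempty_beylGroup_mulEquiv_ker [NeZero k] [NeZero d] [NeZero N] [NeZero M]
    {G : Type*} [Group G] {ν : BaumslagSolitarQuotient r s (d * N) →* G} (hrs : IsCoprime r s)
    (hk : (k * N : ℤ) ∣ r - s) (hμ : k * N * M = (r ^ (d * N) - s ^ (d * N)).natAbs)
    (hrhat : r * rhat ≡ 1 [ZMOD (r ^ (d * N) - s ^ (d * N)).natAbs])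
    (hf : IsCoprime f (k * N : ℤ)) (hα : IsCoprime α d) (hkd : IsCoprime (k : ℤ) d)
    (hj : j.Coprime N) (hjα : j * α ≡ f [ZMOD N])
    (hν : ∀ z x : ℤ, y ^ z * v ^ x ∈ ν.ker ↔ (k * d * N : ℤ) ∣ z * (d * f) - x * (k * α))
    (hcard : Nat.card ν.ker = M * N) (hR : R ≡ (s * rhat) ^ (d * j) [ZMOD M]) :
    Nonempty (BeylGroup M N R 1 ≃* ν.ker) := by
  have hμ0 : (r ^ (d * N) - s ^ (d * N)).natAbs ≠ 0 := hμ ▸ NeZero.ne _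
  obtain ⟨c, hcM, hc⟩ := exists_y_zpow_mul_v_pow_pow_eq hrs hk hμ hrhat hj
  have hclosure := ker_eq_closure_pair hμ hμ0 hrhat hf hα hkd hj hjα hcM hν
  have hpow : (y ^ (k * N * c : ℤ) : BaumslagSolitarQuotient r s (d * N)) ^ M = 1 := by
    rw [← zpow_natCast, ← zpow_mul, show (k * N * c * M : ℤ) = (k * N * M : ℕ) * c by
      push_cast; ring, zpow_mul, zpow_natCast, hμ, y_pow_natAbs, one_zpow]
  obtain ⟨e⟩ := BeylGroup.nonempty_mulEquiv_closure (R := R) (l := 1)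
    (z := y ^ (k : ℤ) * v ^ (d * j)) hpow
    (by rw [mul_mul_zpow_mul_inv (v_pow_mul_y_mul_v_pow_inv hrhat), zpow_eq_zpow_of_modEq hpow hR])
    (by rw [hc, one_mul, gcd_eq_gcd_of_modEq (hR.sub_right 1)])
    (by rw [← hclosure, hcard])
  exact ⟨e.trans (MulEquiv.subgroupCongr hclosure.symm)⟩

end Kernel

section Parameters

/-- The divisibility pattern of `n`, `A` and `f`: one has `(n, A, f) = g`, `(n, A) = g k`,
`(n, f) = g d`, and `N` is what remains of `n`. -/
structure GcdFactorization (n : ℕ) (A f : ℤ) (g k d N : ℕ) (α φ : ℤ) : Prop where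
  n_eq : n = g * k * d * N
  A_eq : A = g * k * α
  f_eq : f = g * d * φ
  isCoprime_k_d : IsCoprime (k : ℤ) d
  isCoprime_α : IsCoprime α (d * N)
  isCoprime_φ : IsCoprime φ (k * N)

theorem exists_eq_mul_eq_mul_isCoprime {m : ℕ} (hm : m ≠ 0) (x : ℤ) :
    ∃ (g m' : ℕ) (x' : ℤ), m = g * m' ∧ x = g * x' ∧ IsCoprime x' m' := by
  obtain ⟨m', hm'⟩ : Int.gcd m x ∣ m := Int.natCast_dvd_natCast.1 (Int.gcd_dvd_left ..)
  obtain ⟨x', hx'⟩ := Int.gcd_dvd_right (a := m) (b := x)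
  refine ⟨Int.gcd m x, m', x', hm', hx', ?_⟩
  have hgcd : Int.gcd m x * Int.gcd m' x' = Int.gcd m x * 1 := by
    rw [mul_one]
    nth_rw 1 [← Int.natAbs_natCast (Int.gcd m x)]
    rw [← Int.gcd_mul_left, ← Nat.cast_mul, ← hm', ← hx']
  exact (Int.isCoprime_iff_gcd_eq_one.2 <| Nat.eq_of_mul_eq_mul_left
    (Nat.pos_of_ne_zero (left_ne_zero_of_mul (hm' ▸ hm))) hgcd).symm

theorem exists_gcdFactorization {n : ℕ} (hn : n ≠ 0) (A f : ℤ) :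
    ∃ (g k d N : ℕ) (α φ : ℤ) (_ : NeZero g) (_ : NeZero k) (_ : NeZero d) (_ : NeZero N),
      GcdFactorization n A f g k d N α φ := by
  obtain ⟨a, m, α, hn_eq, hA_eq, hα⟩ := exists_eq_mul_eq_mul_isCoprime hn A
  rw [hn_eq, mul_ne_zero_iff] at hn
  obtain ⟨g, k, f', rfl, rfl, hf'⟩ := exists_eq_mul_eq_mul_isCoprime hn.1 f
  obtain ⟨d, N, φ, rfl, rfl, hφ⟩ := exists_eq_mul_eq_mul_isCoprime hn.2 f'
  rw [mul_ne_zero_iff, mul_ne_zero_iff] at hn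
  refine ⟨g, k, d, N, α, φ, ⟨hn.1.1⟩, ⟨hn.1.2⟩, ⟨hn.2.1⟩, ⟨hn.2.2⟩, ?_⟩
  exact
    { n_eq := by rw [hn_eq, ← mul_assoc]
      A_eq := by rw [hA_eq, Nat.cast_mul]
      f_eq := by rw [mul_assoc]
      isCoprime_k_d := hf'.of_mul_left_left.symm
      isCoprime_α := by rwa [Nat.cast_mul] at hα
      isCoprime_φ := hf'.of_mul_left_right.mul_right hφ }

namespace GcdFactorization

variable {r s : ℤ} {n : ℕ} {A f : ℤ} {g k d N : ℕ} {α φ : ℤ}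

theorem gcd_n_A (h : GcdFactorization n A f g k d N α φ) : Int.gcd n A = g * k := by
  rw [h.n_eq, h.A_eq, show ((g * k * d * N : ℕ) : ℤ) = (g * k : ℕ) * (d * N) by push_cast; ring,
    show (g * k * α : ℤ) = (g * k : ℕ) * α by rw [Nat.cast_mul], Int.gcd_mul_left,
    Int.isCoprime_iff_gcd_eq_one.1 h.isCoprime_α.symm,
    Int.natAbs_natCast, mul_one]

theorem gcd_n_f (h : GcdFactorization n A f g k d N α φ) : Int.gcd n f = g * d := by
  rw [h.n_eq, h.f_eq, show ((g * k * d * N : ℕ) : ℤ) = (g * d : ℕ) * (k * N) by push_cast; ring,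
    show (g * d * φ : ℤ) = (g * d : ℕ) * φ by rw [Nat.cast_mul], Int.gcd_mul_left,
    Int.isCoprime_iff_gcd_eq_one.1 h.isCoprime_φ.symm,
    Int.natAbs_natCast, mul_one]

theorem gcd_gcd_n_A_f (h : GcdFactorization n A f g k d N α φ) : Int.gcd (Int.gcd n A) f = g := by
  have hk : IsCoprime (k : ℤ) (d * φ) :=
    h.isCoprime_k_d.mul_right (h.isCoprime_φ.of_isCoprime_of_dvd_right (Dvd.intro _ rfl)).symm
  rw [h.gcd_n_A, h.f_eq, Nat.cast_mul, mul_assoc, Int.gcd_mul_left,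
    Int.isCoprime_iff_gcd_eq_one.1 hk, Int.natAbs_natCast, mul_one]

theorem n_div_gcd [NeZero g] [NeZero k] (h : GcdFactorization n A f g k d N α φ) :
    n / (g * k) = d * N := by
  rw [h.n_eq, mul_assoc (g * k), Nat.mul_div_cancel_left _ (NeZero.pos _)]

theorem A_div_gcd [NeZero g] [NeZero k] (h : GcdFactorization n A f g k d N α φ) :
    A / ((g * k : ℕ) : ℤ) = α := by
  rw [h.A_eq, ← Nat.cast_mul, Int.mul_ediv_cancel_left _ (NeZero.ne _)]

theorem f_mul_div_gcd [NeZero g] (h : GcdFactorization n A f g k d N α φ) (x : ℤ) :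
    f * x / g = d * (φ * x) := by
  rw [h.f_eq, mul_assoc (g : ℤ), mul_assoc (g : ℤ), mul_assoc (d : ℤ),
    Int.mul_ediv_cancel_left _ (NeZero.ne _)]

theorem n_mul_gcd_eq (h : GcdFactorization n A f g k d N α φ) : n * g = g * k * (g * d) * N := by
  rw [h.n_eq]
  ring

theorem gcd_mul_eq (h : GcdFactorization n A f g k d N α φ) (M : ℕ) :
    g * d * (k * N * M) = n * M := by
  rw [h.n_eq]
  ring

theorem dvd_sub [NeZero g] [NeZero d] (h : GcdFactorization n A f g k d N α φ)
    (hf : f * (r - s) ≡ 0 [ZMOD n]) : (k * N : ℤ) ∣ r - s := by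
  rw [Int.modEq_zero_iff_dvd, h.n_eq, h.f_eq, mul_assoc _ φ, ← Nat.cast_mul,
    show ((g * k * d * N : ℕ) : ℤ) = (g * d : ℕ) * (k * N) by push_cast; ring,
    mul_dvd_mul_iff_left (NeZero.ne _)] at hf
  exact h.isCoprime_φ.symm.dvd_of_dvd_mul_left hf

theorem dvd_natAbs_pow_sub_pow [NeZero g] [NeZero d] (h : GcdFactorization n A f g k d N α φ)
    (hf : f * (r - s) ≡ 0 [ZMOD n]) (p : ℕ) :
    k * N ∣ (r ^ p - s ^ p).natAbs := by
  rw [← Int.natCast_dvd, Nat.cast_mul]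
  exact (h.dvd_sub hf).trans (sub_dvd_pow_sub_pow r s p)

theorem n_dvd_mul_A_iff [NeZero g] [NeZero k] (h : GcdFactorization n A f g k d N α φ) (x : ℤ) :
    (n : ℤ) ∣ x * A ↔ ((d * N : ℕ) : ℤ) ∣ x := by
  rw [h.n_eq, h.A_eq, show ((g * k * d * N : ℕ) : ℤ) = (g * k) * (d * N) by push_cast; ring,
    mul_left_comm x, mul_dvd_mul_iff_left (mul_ne_zero (NeZero.ne _) (NeZero.ne _)), Nat.cast_mul]
  exact ⟨h.isCoprime_α.symm.dvd_of_dvd_mul_right, fun hx => hx.mul_right α⟩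

theorem n_dvd_mul_f_sub_mul_A_iff [NeZero g] (h : GcdFactorization n A f g k d N α φ) (z x : ℤ) :
    (n : ℤ) ∣ z * f - x * A ↔ (k * d * N : ℤ) ∣ z * (d * φ) - x * (k * α) := by
  rw [h.n_eq, h.A_eq, h.f_eq, show ((g * k * d * N : ℕ) : ℤ) = g * (k * d * N) by push_cast; ring,
    show z * (g * d * φ) - x * (g * k * α) = g * (z * (d * φ) - x * (k * α)) by ring,
    mul_dvd_mul_iff_left (NeZero.ne _)]

end GcdFactorization

theorem powMod_modEq_pow {M p j : ℕ} [NeZero p] {b i : ℤ} (hb : b ^ p ≡ 1 [ZMOD M])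
    (hij : i ≡ j [ZMOD p]) : powMod M b i ≡ b ^ j [ZMOD M] := by
  have hbp : (b : ZMod M) ^ p = 1 := by
    exact_mod_cast (ZMod.intCast_eq_intCast_iff _ _ _).2 hb
  let u : (ZMod M)ˣ := Units.ofPowEqOne b p hbp (NeZero.ne p)
  have hu : u ^ p = 1 := Units.pow_ofPowEqOne hbp (NeZero.ne p)
  rw [← ZMod.intCast_eq_intCast_iff, intCast_powMod (u := u) rfl, zpow_eq_zpow_of_modEq hu hij,
    zpow_natCast, Units.val_pow_eq_pow_val, Int.cast_pow]
  rfl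

theorem exists_natCast_mul_modEq {N : ℕ} [NeZero N] {x α αbar : ℤ} (hx : IsCoprime x N)
    (hα : α * αbar ≡ 1 [ZMOD N]) :
    ∃ j : ℕ, j.Coprime N ∧ j * α ≡ x [ZMOD N] ∧ x * αbar ≡ j [ZMOD N] := by
  obtain ⟨j, hj⟩ : ∃ j : ℕ, (j : ℤ) = x * αbar % N :=
    ⟨_, Int.toNat_of_nonneg (Int.emod_nonneg _ (NeZero.ne _))⟩
  have hmod : x * αbar ≡ j [ZMOD N] := hj ▸ (Int.mod_modEq _ _).symm
  have hjα : j * α ≡ x [ZMOD N] := by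
    calc j * α ≡ x * αbar * α [ZMOD N] := hmod.symm.mul_right α
      _ = x * (α * αbar) := by ring
      _ ≡ x [ZMOD N] := by simpa only [mul_one] using hα.mul_left x
  refine ⟨j, Nat.isCoprime_iff_coprime.1 ?_, hjα, hmod⟩
  obtain ⟨w, hw⟩ := hjα.dvd
  obtain ⟨u, t, hut⟩ := hx
  exact ⟨u * α, t + u * w, by linear_combination hut - u * hw⟩

theorem exists_powMod_modEq_pow {M d N : ℕ} [NeZero d] [NeZero N] {b x α αbar : ℤ}
    (hb : b ^ (d * N) ≡ 1 [ZMOD M]) (hx : IsCoprime x N) (hα : α * αbar ≡ 1 [ZMOD (d * N : ℕ)]) :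
    ∃ j : ℕ, j.Coprime N ∧ j * α ≡ x [ZMOD N] ∧
      powMod M b (d * (x * αbar)) ≡ b ^ (d * j) [ZMOD M] := by
  rw [Nat.cast_mul] at hα
  obtain ⟨j, hj, hjα, hjx⟩ := exists_natCast_mul_modEq hx (hα.of_dvd (Dvd.intro_left _ rfl))
  exact ⟨j, hj, hjα, powMod_modEq_pow hb (by push_cast; exact hjx.mul_left')⟩

end Parameters

section Structure

open BaumslagSolitarQuotient Monoid

namespace GcdFactorization

variable {r s rhat R : ℤ} {n : ℕ} {A f : ℤ} {g k d N M j : ℕ} {α φ : ℤ}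

theorem card_ker [NeZero n] [NeZero k] [NeZero d] [NeZero N] [NeZero M]
    {ν : BaumslagSolitarQuotient r s (d * N) →* Multiplicative (ZMod n)}
    (h : GcdFactorization n A f g k d N α φ)
    (hμ : k * N * M = (r ^ (d * N) - s ^ (d * N)).natAbs)
    (hrhat : r * rhat ≡ 1 [ZMOD (r ^ (d * N) - s ^ (d * N)).natAbs])
    (hνy : ν y = Multiplicative.ofAdd (f : ZMod n))
    (hνv : ν v = (Multiplicative.ofAdd (A : ZMod n))⁻¹) : Nat.card ν.ker = M * N := by
  have hrange : Nat.card ν.range * g = n := by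
    have hcard := Subgroup.card_mul_index ν.range
    rwa [index_range_eq_gcd hνy hνv, h.gcd_gcd_n_A_f, Nat.card_congr Multiplicative.toAdd,
      Nat.card_zmod] at hcard
  have hker : Nat.card ν.ker * Nat.card ν.range = k * N * M * (d * N) := by
    rw [← Subgroup.index_ker, Subgroup.card_mul_index,
      card_eq (hμ ▸ NeZero.ne _) hrhat, ← hμ]
  refine Nat.eq_of_mul_eq_mul_right (NeZero.pos n) ?_
  calc Nat.card ν.ker * n = Nat.card ν.ker * Nat.card ν.range * g := by rw [mul_assoc, hrange]
    _ = M * N * n := by rw [hker, h.n_eq]; ring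

theorem nonempty_groupM_mulEquiv [NeZero n] [NeZero g] [NeZero k] [NeZero d] [NeZero N]
    [NeZero M] (h : GcdFactorization n A f g k d N α φ) (hrs : IsCoprime r s)
    (hf : f * (r - s) ≡ 0 [ZMOD n]) (hμ : k * N * M = (r ^ (d * N) - s ^ (d * N)).natAbs)
    (hrhat : r * rhat ≡ 1 [ZMOD (r ^ (d * N) - s ^ (d * N)).natAbs])
    (hj : j.Coprime N) (hjα : j * α ≡ φ [ZMOD N]) (hR : R ≡ (s * rhat) ^ (d * j) [ZMOD M]) :
    Nonempty (GroupM r n s f A ≃*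
      Coprod (CoprodI fun _ : Fin g => BeylGroup M N R 1) (FreeGroup (Fin (g * k - g)))) := by
  obtain ⟨ν, hνy, hνv⟩ := exists_hom_multiplicative_zmod (p := d * N) hf
    ((h.n_dvd_mul_A_iff _).2 dvd_rfl)
  have hdisj : Disjoint ν.ker (Subgroup.zpowers v) :=
    disjoint_ker_zpowers_v hνv fun x => (h.n_dvd_mul_A_iff x).1
  obtain ⟨eker⟩ := nonempty_beylGroup_mulEquiv_ker hrs (h.dvd_sub hf) hμ hrhat h.isCoprime_φ
    h.isCoprime_α.of_mul_right_left h.isCoprime_k_d hj hjα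
    (fun z x => (map_zpow_mul_zpow_eq_one_iff hνy hνv z x).trans
      (h.n_dvd_mul_f_sub_mul_A_iff z x))
    (h.card_ker hμ hrhat hνy hνv) hR
  obtain ⟨eG⟩ := nonempty_groupM_mulEquiv_cocycleGroup hνy hνv
  obtain ⟨esplit⟩ := nonempty_cocycleGroup_mulEquiv_of_disjoint hdisj eker.symm
  rw [index_range_eq_gcd hνy hνv, index_map_zpowers_v_eq_gcd hνv, h.gcd_gcd_n_A_f,
    h.gcd_n_A] at esplit
  exact ⟨eG.trans esplit⟩

end GcdFactorization

theorem mul_pow_modEq_one_of_mul_eq_natAbs {r s rhat : ℤ} {m M p : ℕ}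
    (hμ : m * M = (r ^ p - s ^ p).natAbs)
    (hrhat : r * rhat ≡ 1 [ZMOD (r ^ p - s ^ p).natAbs]) : (s * rhat) ^ p ≡ 1 [ZMOD M] :=
  (mul_pow_modEq_one (modEq_natAbs_sub _ _) hrhat).of_dvd
    (Int.natCast_dvd_natCast.2 (hμ ▸ Dvd.intro_left m rfl))

theorem pow_modEq_one_of_modEq_pow {b R : ℤ} {M d N j : ℕ} (hb : b ^ (d * N) ≡ 1 [ZMOD M])
    (hR : R ≡ b ^ (d * j) [ZMOD M]) : R ^ N ≡ 1 [ZMOD M] := by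
  calc R ^ N ≡ (b ^ (d * j)) ^ N [ZMOD M] := hR.pow N
    _ = (b ^ (d * N)) ^ j := by ring
    _ ≡ 1 [ZMOD M] := by simpa only [one_pow] using hb.pow j

end Structure

theorem theoremC
    (r : ℤ) (n : ℕ) (s f A : ℤ) (hn : 0 < n)
    (hf : f * (r - s) ≡ 0 [ZMOD n])
    (hrs : Int.gcd r s = 1)
    -- `dA = (n, A)`, `df = (n, f)`, `dAf = (n, A, f)`
    (dA df dAf : ℕ) (hdA : dA = Int.gcd n A) (hdf : df = Int.gcd n f)
    (hdAf : dAf = Int.gcd dA f)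
    (μ : ℕ) (hμ : μ = (r ^ (n / dA) - s ^ (n / dA)).natAbs) (hμ0 : μ ≠ 0)
    (rhat : ℤ) (hrhat : r * rhat ≡ 1 [ZMOD μ])
    (α αbar : ℤ) (hα : α = A / (dA : ℤ)) (hαbar : α * αbar ≡ 1 [ZMOD (n / dA : ℕ)])
    -- the parameters of `Gbar = B(M, N, R, 1)`
    (M N : ℕ) (hM : M = df * μ / n) (hN : N = n * dAf / (dA * df))
    (R : ℤ) (hR : R = powMod M (s * rhat) (f * αbar / (dAf : ℤ))) :
    -- `M` and `N` are integers, and `B(M, N, R, 1)` is a finite metacyclic group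
    (n ∣ df * μ ∧ dA * df ∣ n * dAf ∧ R ^ N ≡ 1 [ZMOD M] ∧
      Finite (BeylGroup M N R 1) ∧ IsMetacyclic (BeylGroup M N R 1)) ∧
    Nonempty (GroupM r n s f A ≃*
      Monoid.Coprod (Monoid.CoprodI fun _ : Fin dAf => BeylGroup M N R 1)
        (FreeGroup (Fin (dA - dAf)))) ∧
    (dA * df = n * dAf →
      Nonempty (GroupM r n s f A ≃*
        Monoid.Coprod (Monoid.CoprodI fun _ : Fin dAf => Multiplicative (ZMod M))
          (FreeGroup (Fin (dA - dAf))))) := by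
  obtain ⟨g, k, d, N', α', φ, _, _, _, _, h⟩ := exists_gcdFactorization hn.ne' A f
  have : NeZero n := ⟨hn.ne'⟩
  obtain rfl : dAf = g := by rw [hdAf, hdA, h.gcd_gcd_n_A_f]
  obtain rfl : dA = dAf * k := hdA.trans h.gcd_n_A
  obtain rfl : df = dAf * d := hdf.trans h.gcd_n_f
  obtain rfl : N = N' := by rw [hN, h.n_mul_gcd_eq, Nat.mul_div_cancel_left _ (NeZero.pos _)]
  obtain rfl : α = α' := hα.trans h.A_div_gcd
  rw [h.n_div_gcd] at hμ hαbar
  rw [h.f_mul_div_gcd] at hR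
  obtain ⟨M', rfl⟩ : k * N ∣ μ := hμ ▸ h.dvd_natAbs_pow_sub_pow hf (d * N)
  obtain rfl : M = M' := by rw [hM, h.gcd_mul_eq, Nat.mul_div_cancel_left _ hn]
  have : NeZero M := ⟨right_ne_zero_of_mul hμ0⟩
  rw [hμ] at hrhat
  have hb := mul_pow_modEq_one_of_mul_eq_natAbs hμ hrhat
  obtain ⟨j, hj, hjα, hRj⟩ := exists_powMod_modEq_pow hb h.isCoprime_φ.of_mul_right_right hαbar
  have hRN := pow_modEq_one_of_modEq_pow hb (hR ▸ hRj)
  obtain ⟨e⟩ := h.nonempty_groupM_mulEquiv (Int.isCoprime_iff_gcd_eq_one.2 hrs) hf hμ hrhat hj hjα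
    (hR ▸ hRj)
  refine ⟨⟨⟨M, h.gcd_mul_eq M⟩, ⟨N, h.n_mul_gcd_eq⟩, hRN, inferInstance, BeylGroup.isMetacyclic⟩,
    ⟨e⟩, fun hN1 => ?_⟩
  obtain rfl : N = 1 := (Nat.mul_eq_left (NeZero.ne _)).1 (hN1.trans h.n_mul_gcd_eq).symm
  obtain ⟨e₁⟩ := BeylGroup.nonempty_mulEquiv_multiplicative_zmod (l := 1) (pow_one R ▸ hRN)
  exact ⟨e.trans (MulEquiv.coprodCongr (coprodIConstCongr (Equiv.refl _) e₁) (MulEquiv.refl _))⟩
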